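/- **Theorem.** Let $q$ be a prime power, let $n$ be a positive integer with $\gcd(n,q)=1$, put $r=\mathrm{ord}_n(q^2)$, and let $$2\le 2\delta<\left\lfloor \frac{n(q^r-1)}{q^{2r}-1}\right\rfloor ,\qquad \kappa=r\lceil \delta(1-1/q^2)\rceil .$$ Let $\zeta$ be a primitive $n$-th root of unity in an extension field of $\mathbf F_{q^2}$. For $Z\subseteq\{0,\dots,n-1\}$ the cyclic code over $\mathbf F_{q^2}$ with defining set $Z$ consists of the $c\in\mathbf F_{q^2}^n$ with $\sum_j c_j\zeta^{jz}=0$ for all $z\in Z$. Let $C_x=\{xq^{2i}\bmod n: i\ge 0\}$; let $B_d$ be the (narrow-sense BCH) code with defining set $C_1\cup\dots\cup C_{d-1}$, and $B'$ the cyclic code with defining set $\bigcup\{C_x:\delta+1\le x\le 2\delta,\ q^2\nmid x\}$. For $a\le b$ put $$\Delta(a,b)=\begin{cases} q^2+\lfloor (b-a+3)/q^2\rfloor-2, & b-a\ge 2q^2-3,\\ \lfloor (b-a+3)/2\rfloor, & \text{otherwise,}\end{cases}$$ which is a lower bound for the minimum distance of the cyclic code over $\mathbf F_{q^2}$ with defining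 set $\bigcup\{C_x:a\le x\le b,\ q^2\nmid x\}$ whenever $2\le a\le b<n$ and that code is nonzero. Then $2\kappa\le n$, and there is a quantum convolutional code with parameters $[(n,n-2\kappa,1)]_q$ whose free distance $d_f$ satisfies $$d_f\ \ge\ \delta+1+\Delta(\delta+1,2\delta),$$ and also $d_f\ge\min\{\delta+1+d(B'),\,d(B_{2\delta+1})\}$, where $d(\cdot)$ denotes the minimum distance of a block code. It comes from a convolutional BCH code $W\subseteq\mathbf F_{q^2}[D]^n$ of dimension $n-\kappa$ and memory $1$ that contains its Hermitian dual: the stabilizer of the quantum code is $W^{\perp_h}\subseteq W$, under the coordinatewise identification $(x\,|\,z)\mapsto\beta_0x+\beta_1z$ of $\mathbf F_q[D]^{2n}$ with $\mathbf F_{q^2}[D]^n$ for a basis $\beta_0,\beta_1$ of $\mathbf F_{q^2}$ over $\mathbf F_q$. Here a convolutional code is a free direct summand of $\mathbf F_{q^2}[D]^n$, and its memory is the largest row degree of a generator matrix with the least possible sum of row degrees. Duals are taken with respect to all shifts: $W^{\perp_h}$ is the set of all $u(D)=\sum_i u_iD^i$ such that $\langle D^l u,w\rangle_h=0$ for all $l\ge0$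 and $w\in W$, where $\langle u,w\rangle_h=\sum_i u_i\cdot w_i^{\,q}$; similarly for the Euclidean dual with $\sum_i u_i\cdot w_i$. The code $W$ is a convolutional BCH code if it is the Euclidean dual of the code generated by $H_0+D\widetilde H_1$, where $H_0$, $H_1$ and $\binom{H_0}{H_1}$ are parity check matrices (with linearly independent rows) of $B_{\delta+1}$, $B'$ and $B_{2\delta+1}$, respectively, $H_1$ has at most as many rows as $H_0$, and $\widetilde H_1$ is $H_1$ filled up with zero rows at the bottom. A quantum convolutional code with parameters $[(n,k,m)]_q$ is given by a stabilizer matrix $S(D)=(X(D)|Z(D))\in\mathbf F_q[D]^{(n-k)\times 2n}$ that has a polynomial right inverse, whose entries have maximal degree $m$, and with $X(D)Z(1/D)^t-Z(D)X(1/D)^t=0$. Its stabilizer is the $\mathbf F_q[D]$-module generated by the rows of $S(D)$, and its free distance is the least weight (number of pairs (position, power of $D$) at which the coefficients of $x$ and $z$ are not both zero) of a word $(x\,|\,z)\in\mathbf F_q[D]^{2n}$ that is symplectically orthogonal to the stabilizer (with $X(D)Z(1/D)^t-Z(D)X(1/D)^t$ as the form) but does not lie in it. -/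

import Mathlib

open Polynomial

noncomputable section

namespace QConv

/-! ## Cyclic and BCH block codes -/

/-- The cyclotomic coset `{x Q^i mod n : i ≥ 0}`. -/
def cyclotomicCoset (Q n x : ℕ) : Set ℕ := {z | ∃ i : ℕ, z = x * Q ^ i % n}

/-- The cyclic code of length `n` over `K` with defining set `Z`, with respect to the primitive
`n`-th root of unity `ζ` in an extension field `E` of `K`: the words `c` whose polynomial
`∑ c_j x^j` vanishes at `ζ^z` for all `z ∈ Z`. -/
def cyclicCode (K : Type*) [Field K] {E : Type*} [Field E] [Algebra K E] (ζ : E) (n : ℕ)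
    (Z : Set ℕ) : Submodule K (Fin n → K) where
  carrier := {c | ∀ z ∈ Z, ∑ j, algebraMap K E (c j) * (ζ ^ z) ^ (j : ℕ) = 0}
  zero_mem' := by intro z _; simp
  add_mem' := by
    intro a b ha hb z hz
    simp only [Pi.add_apply, map_add, add_mul, Finset.sum_add_distrib, ha z hz, hb z hz, add_zero]
  smul_mem' := by
    intro a c hc z hz
    simp only [Pi.smul_apply, smul_eq_mul, map_mul, mul_assoc, ← Finset.mul_sum, hc z hz, mul_zero]

/-- The defining set `C_b ∪ C_{b+1} ∪ ⋯ ∪ C_{b+d-2}` of a BCH code of designed distance `d`. -/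
def bchDefiningSet (Q n d b : ℕ) : Set ℕ :=
  {z | ∃ x, b ≤ x ∧ x + 2 ≤ b + d ∧ z ∈ cyclotomicCoset Q n x}

/-- The narrow-sense BCH code of length `n` and designed distance `d` over the finite field `K`. -/
def bchCode (K : Type*) [Field K] {E : Type*} [Field E] [Algebra K E] (ζ : E) (n d : ℕ) :
    Submodule K (Fin n → K) :=
  cyclicCode K ζ n (bchDefiningSet (Nat.card K) n d 1)

/-- The defining set `⋃ C_x` over `a ≤ x ≤ b` with `x ≢ 0 mod Q`. -/
def intervalDefiningSet (Q n a b : ℕ) : Set ℕ :=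
  {z | ∃ x, a ≤ x ∧ x ≤ b ∧ ¬ Q ∣ x ∧ z ∈ cyclotomicCoset Q n x}

/-- The cyclic code over `K` with defining set `{z ∈ C_x : a ≤ x ≤ b, x ≢ 0 mod |K|}`. -/
def intervalCode (K : Type*) [Field K] {E : Type*} [Field E] [Algebra K E] (ζ : E) (n a b : ℕ) :
    Submodule K (Fin n → K) :=
  cyclicCode K ζ n (intervalDefiningSet (Nat.card K) n a b)

/-- The minimum distance of a (nonzero) linear block code. -/
def minDist {K : Type*} [Field K] [DecidableEq K] {n : ℕ} (C : Submodule K (Fin n → K)) : ℕ :=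
  sInf {w | ∃ c ∈ C, c ≠ 0 ∧ hammingNorm c = w}

/-- The explicit lower bound `Δ(a,b)` for the minimum distance of the cyclic code over a field with
`Q` elements that has defining set `{z ∈ C_x : a ≤ x ≤ b, x ≢ 0 mod Q}`; meant for `a ≤ b`, and the
case condition `b - a ≥ 2Q - 3` is written without subtraction of the `3`. -/
def distBound (Q a b : ℕ) : ℕ :=
  if 2 * Q ≤ b - a + 3 then Q + (b - a + 3) / Q - 2 else (b - a + 3) / 2

/-- `H` is a parity check matrix of the block code `C`: the rows of `H` are linearly independent and
`C = {v : v Hᵗ = 0}`. -/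
def IsParityCheck {K : Type*} [Field K] {ι : Type*} {n : ℕ} (H : Matrix ι (Fin n) K)
    (C : Submodule K (Fin n → K)) : Prop :=
  LinearIndependent K (fun i => H i) ∧ ∀ v, v ∈ C ↔ H.mulVec v = 0

/-! ## Classical convolutional codes -/

/-- A convolutional code of length `n` and dimension `k` over `K`: a free submodule of rank `k`
of `K[D]^n` that is a direct summand. -/
def IsConvolutionalCode {K : Type*} [Field K] {n : ℕ} (C : Submodule K[X] (Fin n → K[X]))
    (k : ℕ) : Prop :=
  Module.Free K[X] C ∧ Module.finrank K[X] C = k ∧ ∃ C' : Submodule K[X] (Fin n → K[X]), IsCompl C C'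

/-- The row module `{u G : u ∈ K[D]^k}` of a polynomial matrix. -/
def rowModule {K : Type*} [Field K] {n k : ℕ} (G : Matrix (Fin k) (Fin n) K[X]) :
    Submodule K[X] (Fin n → K[X]) :=
  Submodule.span K[X] (Set.range fun i => G i)

/-- The maximum degree `ν_i` of the entries of the `i`-th row. -/
def rowDegree {K : Type*} [Field K] {n k : ℕ} (G : Matrix (Fin k) (Fin n) K[X]) (i : Fin k) : ℕ :=
  Finset.univ.sup fun j => (G i j).natDegree

/-- `C` is a convolutional code of dimension `k` and memory `m`: it has a basic generator matrix `G`
with `k` rows that is reduced (its overall constraint length `ν_1 + ⋯ + ν_k` is the smallest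
among all basic generator matrices of `C`) and whose largest row degree is `m`. -/
def IsConvolutionalCodeWithMemory {K : Type*} [Field K] {n : ℕ}
    (C : Submodule K[X] (Fin n → K[X])) (k m : ℕ) : Prop :=
  IsConvolutionalCode C k ∧
  ∃ G : Matrix (Fin k) (Fin n) K[X], rowModule G = C ∧
    (∀ G' : Matrix (Fin k) (Fin n) K[X], rowModule G' = C →
      ∑ i, rowDegree G i ≤ ∑ i, rowDegree G' i) ∧
    Finset.univ.sup (rowDegree G) = m

/-- The inner product `∑_i u_i · σ(v_i)` of `u(D) = ∑ u_i D^i` and `v(D) = ∑ v_i D^i`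
(`u_i, v_i ∈ K^n`), where `σ` acts on coordinates. -/
def convInner {K : Type*} [Field K] {n : ℕ} (σ : K → K) (u v : Fin n → K[X]) : K :=
  ∑ j, (u j).sum fun i a => a * σ ((v j).coeff i)

/-- The dual code with respect to `convInner σ`: the words all of whose multiples by polynomials in
`D` (equivalently, all of whose shifts `D^l u(D)`) are orthogonal to `C`. -/
def convDual {K : Type*} [Field K] {n : ℕ} (σ : K → K) (C : Submodule K[X] (Fin n → K[X])) :
    Submodule K[X] (Fin n → K[X]) where
  carrier := {u | ∀ p : K[X], ∀ v ∈ C, convInner σ (p • u) v = 0}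
  zero_mem' := by intro p v _; simp [convInner]
  add_mem' := by
    intro a b ha hb p v hv
    have key : convInner σ (p • (a + b)) v = convInner σ (p • a) v + convInner σ (p • b) v := by
      simp only [convInner, smul_add, Pi.add_apply]
      rw [← Finset.sum_add_distrib]
      refine Finset.sum_congr rfl fun j _ => ?_
      exact Polynomial.sum_add_index _ _ _ (fun i => by simp) (fun i x y => by ring)
    rw [key, ha p v hv, hb p v hv, add_zero]
  smul_mem' := by
    intro c u hu p v hv
    rw [smul_smul]
    exact hu (p * c) v hv

/-- The Euclidean dual of a convolutional code. -/
def euclideanDual {K : Type*} [Field K] {n : ℕ} (C : Submodule K[X] (Fin n → K[X])) :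
    Submodule K[X] (Fin n → K[X]) := convDual (fun x => x) C

/-- The Hermitian dual of a convolutional code over a field with `q²` elements. -/
def hermitianDual {K : Type*} [Field K] {n : ℕ} (q : ℕ) (C : Submodule K[X] (Fin n → K[X])) :
    Submodule K[X] (Fin n → K[X]) := convDual (fun x => x ^ q) C

/-- The polynomial matrix `H₀ + D H̃₁`, where `H̃₁` is `H₁` with zero rows added at the bottom. -/
def unitMemoryMatrix {K : Type*} [Field K] {n κ μ : ℕ} (H₀ : Matrix (Fin κ) (Fin n) K)
    (H₁ : Matrix (Fin μ) (Fin n) K) : Matrix (Fin κ) (Fin n) K[X] :=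
  fun i j => Polynomial.C (H₀ i j) +
    Polynomial.X * Polynomial.C (if h : (i : ℕ) < μ then H₁ ⟨i, h⟩ j else 0)

/-- `W` is a convolutional BCH code obtained from the narrow-sense BCH code of length `n`
and designed distance `2δ+1` over `K`: a parity check matrix of that code is split into a parity
check matrix `H₀` of the BCH code of designed distance `δ+1` and a matrix `H₁` with at most as
many rows, which is a parity check matrix of the cyclic code with defining set
`{z ∈ C_x : δ+1 ≤ x ≤ 2δ, x ≢ 0 mod |K|}`; then `W` is the dual of the code generated by
`H₀ + D H̃₁`. -/
def IsConvolutionalBCH {K : Type*} [Field K] {E : Type*} [Field E] [Algebra K E] (ζ : E)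
    {n : ℕ} (δ : ℕ) (W : Submodule K[X] (Fin n → K[X])) : Prop :=
  ∃ (κ μ : ℕ) (H₀ : Matrix (Fin κ) (Fin n) K) (H₁ : Matrix (Fin μ) (Fin n) K),
    μ ≤ κ ∧
    IsParityCheck H₀ (bchCode K ζ n (δ + 1)) ∧
    IsParityCheck H₁ (intervalCode K ζ n (δ + 1) (2 * δ)) ∧
    IsParityCheck (Matrix.fromRows H₀ H₁) (bchCode K ζ n (2 * δ + 1)) ∧
    W = euclideanDual (rowModule (unitMemoryMatrix H₀ H₁))

/-! ## Quantum convolutional codes -/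

/-- Substitution of `D` into a polynomial matrix, with entries in the Laurent polynomials. -/
def atD {F : Type*} [Field F] {m n : ℕ} (A : Matrix (Fin m) (Fin n) F[X]) :
    Matrix (Fin m) (Fin n) (LaurentPolynomial F) :=
  A.map fun p => Polynomial.toLaurent p

/-- Substitution of `1/D` into a polynomial matrix. -/
def atInvD {F : Type*} [Field F] {m n : ℕ} (A : Matrix (Fin m) (Fin n) F[X]) :
    Matrix (Fin m) (Fin n) (LaurentPolynomial F) :=
  A.map fun p => LaurentPolynomial.invert (Polynomial.toLaurent p)

/-- A quantum convolutional (stabilizer) code with frame size `n` and `k` logical qudits per frame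
over `F`, given by its stabilizer matrix `S(D) = (X(D) | Z(D))` with `n - k` rows. It satisfies
`X(D) Z(1/D)ᵗ - Z(D) X(1/D)ᵗ = 0`, and it is a basic generator matrix (it has a polynomial
right inverse). -/
structure QuantumConvolutionalCode (F : Type*) [Field F] (n k : ℕ) where
  le : k ≤ n
  xPart : Matrix (Fin (n - k)) (Fin n) F[X]
  zPart : Matrix (Fin (n - k)) (Fin n) F[X]
  symplectic : atD xPart * (atInvD zPart).transpose - atD zPart * (atInvD xPart).transpose = 0
  basic : ∃ P : Matrix (Fin n ⊕ Fin n) (Fin (n - k)) F[X], Matrix.fromCols xPart zPart * P = 1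

namespace QuantumConvolutionalCode

variable {F : Type*} [Field F] {n k : ℕ}

/-- The memory: the largest degree of an entry of `X(D)` and `Z(D)`. -/
def memory (Q : QuantumConvolutionalCode F n k) : ℕ :=
  Finset.univ.sup fun i => Finset.univ.sup fun j =>
    max (Q.xPart i j).natDegree (Q.zPart i j).natDegree

/-- The module over `F[D]` that is generated by the rows of the stabilizer matrix. -/
def stabilizer (Q : QuantumConvolutionalCode F n k) :
    Submodule F[X] ((Fin n → F[X]) × (Fin n → F[X])) :=
  Submodule.span F[X] (Set.range fun i => (Q.xPart i, Q.zPart i))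

end QuantumConvolutionalCode

/-- The symplectic form `x(D) z'(1/D)ᵗ - z(D) x'(1/D)ᵗ` of `(x | z)` and `(x' | z')`. -/
def symplecticForm {F : Type*} [Field F] {n : ℕ} (s t : (Fin n → F[X]) × (Fin n → F[X])) :
    LaurentPolynomial F :=
  ∑ j, (Polynomial.toLaurent (s.1 j) * LaurentPolynomial.invert (Polynomial.toLaurent (t.2 j)) -
    Polynomial.toLaurent (s.2 j) * LaurentPolynomial.invert (Polynomial.toLaurent (t.1 j)))

/-- The weight of `(x | z)`: the number of qudits, i.e. of pairs (position `j`, frame `i`), at which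
the coefficients `x_{j,i}`, `z_{j,i}` are not both zero. -/
def symplecticWeight {F : Type*} [Field F] {n : ℕ} (s : (Fin n → F[X]) × (Fin n → F[X])) : ℕ :=
  ∑ j, ((s.1 j).support ∪ (s.2 j).support).card

/-- The free distance: the least weight of a word that is symplectically orthogonal to the
stabilizer without belonging to it. -/
def QuantumConvolutionalCode.freeDistance {F : Type*} [Field F] {n k : ℕ}
    (Q : QuantumConvolutionalCode F n k) : ℕ :=
  sInf {w | ∃ s, (∀ t ∈ Q.stabilizer, symplecticForm s t = 0) ∧ s ∉ Q.stabilizer ∧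
    symplecticWeight s = w}

/-- The stabilizer of `Q` is the code `V` over the quadratic extension `K` of `F`, under the
identification `(x | z) ↦ β₀ x + β₁ z` given by a basis `β₀, β₁` of `K` over `F`. -/
def QuantumConvolutionalCode.HasStabilizerCode {F : Type*} [Field F] {n k : ℕ}
    (Q : QuantumConvolutionalCode F n k) {K : Type*} [Field K] [Algebra F K]
    (V : Submodule K[X] (Fin n → K[X])) : Prop :=
  ∃ β : Module.Basis (Fin 2) F K, ∀ x z : Fin n → F[X], (x, z) ∈ Q.stabilizer ↔
    (fun j => Polynomial.C (β 0) * (x j).map (algebraMap F K) +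
      Polynomial.C (β 1) * (z j).map (algebraMap F K)) ∈ V

end QConv

end

/-! Put M = 2δ. Since q^(2r) - 1 = (q^r - 1)(q^r + 1), the floor condition forces M(q^r + 1) < n,
and all the coset arithmetic rests on this inequality. Because q^(2r) ≡ 1 mod n, a relation modulo n
between x q^a and y q^b with x, y ≤ M can be rotated until the exponent is at most r; then all
numbers involved are below n and the relation is one between integers. Hence the cosets of the x ≤ M
not divisible by q² are disjoint and of full size r (`injOn_mul_pow_mod`), which makes the
dimensions exact (`finrank_evalCode`); and n never divides x q^a + y q^b
(`not_dvd_mul_pow_add_mul_pow`), which makes the dual of B_{2δ+1} Hermitian self-orthogonal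
(`hermitian_orthogonal`).

A right inverse of the stacked parity check matrix yields explicit generators of W: constant words
from B_{2δ+1} and μ words of degree one (`span_eq_unitMemoryDual`). They give the memory, and they
show that the Hermitian dual of W is the row module of the conjugate of H₀ + D H̃₁
(`convDual_unitMemoryDual`). That module lies in W by self-orthogonality of the rows.

For the distance, the lowest nonzero coefficient of a word of W lies in B' and the highest in
B_{δ+1} (`exists_first_last`). If they sit at different powers of D, their weights add; if they
coincide, the coefficient lies in B_{2δ+1}. The BCH and Hartmann–Tzeng bounds supply the numbers.

For the passage to quantum codes, the Hermitian product minus its conjugate is a nonzero constant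
times the symplectic form (`laurentInner_sub_conj`). For modules over K[D] the two orthogonalities
therefore agree, and the words orthogonal to the stabilizer are exactly those of W. As W has rank n
- κ > κ, some of them lie outside the stabilizer, so the free distance is attained and bounded by
the weights in W. -/

namespace QConv

/-! ## Weights of words with structured zeros -/

/-- The Hartmann–Tzeng bound for zeros `ζ^(a+i+Qt)`, `i < m`, `t ≤ s`, where `Q` is prime to the
length. The BCH bound is the case `s = 0`. -/
theorem hartmannTzeng_bound {E : Type*} [Field E] [DecidableEq E] {ζ : E} {n : ℕ}
    (hζ : IsPrimitiveRoot ζ n) {Q : ℕ} (hQ : Nat.Coprime Q n) {c : Fin n → E} (hc : c ≠ 0)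
    {a m s : ℕ} (hm : 1 ≤ m)
    (h : ∀ i < m, ∀ t ≤ s, ∑ j, c j * (ζ ^ (a + i + Q * t)) ^ (j : ℕ) = 0) :
    m + s + 1 ≤ hammingNorm c := by
  by_contra! hlt
  obtain ⟨k₀, hk₀⟩ : ∃ k, c k ≠ 0 := by
    by_contra! h0
    exact hc (funext h0)
  set S : Finset (Fin n) := (Finset.univ.filter fun k => c k ≠ 0).erase k₀ with hS
  have hScard : S.card + 1 = hammingNorm c := by
    rw [hS, Finset.card_erase_add_one (by simp [hk₀])]
    rfl
  -- The support positions other than `k₀` are divided between two annihilators: at most s of them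
  -- become roots of `g` in the variable y^Q, and the fewer than m others become roots of `f` in y.
  obtain ⟨A, hAS, hA⟩ := Finset.exists_subset_card_eq (Nat.min_le_right s S.card)
  have hB : (S \ A).card < m := by
    rw [Finset.card_sdiff_of_subset hAS, hA]
    omega
  set f : E[X] := ∏ k ∈ S \ A, (X - C (ζ ^ (k : ℕ))) with hf
  set g : E[X] := ∏ k ∈ A, (X - C ((ζ ^ (k : ℕ)) ^ Q)) with hg
  have hfd : f.natDegree < m := by
    rw [hf, natDegree_finsetProd_X_sub_C_eq_card]; exact hB
  have hgd : g.natDegree < s + 1 := by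
    rw [hg, natDegree_finsetProd_X_sub_C_eq_card A (fun k : Fin n => (ζ ^ (k : ℕ)) ^ Q), hA]
    omega
  -- The degrees of `f` and `g` are such that expanding both uses only the prescribed zeros a + i +
  -- Qt.
  have hsum : ∑ k, c k * (ζ ^ (k : ℕ)) ^ a * f.eval (ζ ^ (k : ℕ)) *
      g.eval ((ζ ^ (k : ℕ)) ^ Q) = 0 := by
    have key : ∀ k : Fin n, c k * (ζ ^ (k : ℕ)) ^ a * f.eval (ζ ^ (k : ℕ)) *
        g.eval ((ζ ^ (k : ℕ)) ^ Q) = ∑ i ∈ Finset.range m, ∑ t ∈ Finset.range (s + 1),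
          f.coeff i * g.coeff t * (c k * (ζ ^ (a + i + Q * t)) ^ (k : ℕ)) := by
      intro k
      rw [eval_eq_sum_range' hfd, eval_eq_sum_range' hgd, mul_assoc, Finset.sum_mul_sum,
        Finset.mul_sum]
      refine Finset.sum_congr rfl fun i _ => ?_
      rw [Finset.mul_sum]
      refine Finset.sum_congr rfl fun t _ => ?_
      rw [pow_right_comm ζ (a + i + Q * t), pow_add, pow_add, pow_mul]
      ring
    rw [Finset.sum_congr rfl fun k _ => key k, Finset.sum_comm]
    refine Finset.sum_eq_zero fun i hi => ?_
    rw [Finset.sum_comm]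
    refine Finset.sum_eq_zero fun t ht => ?_
    rw [← Finset.mul_sum, h i (Finset.mem_range.1 hi) t (by simpa [Nat.lt_succ_iff] using ht),
      mul_zero]
  -- Only the term of `k₀` survives, and it is nonzero; for `g` this uses that ζ^Q is again a
  -- primitive n-th root of unity.
  rw [Finset.sum_eq_single k₀] at hsum
  · have hinj : ∀ k ∈ S, ζ ^ (k₀ : ℕ) ≠ ζ ^ (k : ℕ) := fun k hk he =>
      (Finset.mem_erase.1 hk).1 (Fin.ext (hζ.pow_inj k₀.2 k.2 he)).symm
    have hζ0 : ζ ≠ 0 := hζ.ne_zero (by have := k₀.2; omega)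
    refine mul_ne_zero (mul_ne_zero (mul_ne_zero hk₀ (by positivity)) ?_) ?_ hsum
    · rw [hf, eval_prod]
      refine Finset.prod_ne_zero_iff.2 fun k hk => ?_
      simpa [sub_ne_zero] using hinj k (Finset.mem_sdiff.1 hk).1
    · rw [hg, eval_prod]
      refine Finset.prod_ne_zero_iff.2 fun k hk => ?_
      have := hinj k (hAS hk)
      simp only [eval_sub, eval_X, eval_C, sub_ne_zero]
      intro he
      rw [← pow_mul, ← pow_mul, mul_comm, mul_comm (k : ℕ), pow_mul, pow_mul] at he
      exact (Finset.mem_erase.1 (hAS hk)).1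
        (Fin.ext ((hζ.pow_of_coprime Q hQ).pow_inj k₀.2 k.2 he)).symm
  · intro k _ hk
    by_cases hck : c k = 0
    · simp [hck]
    have hkS : k ∈ S := Finset.mem_erase.2 ⟨hk, by simpa using hck⟩
    by_cases hkA : k ∈ A
    · have : g.eval ((ζ ^ (k : ℕ)) ^ Q) = 0 := by
        rw [hg, eval_prod]
        exact Finset.prod_eq_zero hkA (by simp)
      rw [this, mul_zero]
    · have : f.eval (ζ ^ (k : ℕ)) = 0 := by
        rw [hf, eval_prod]
        exact Finset.prod_eq_zero (Finset.mem_sdiff.2 ⟨hkS, hkA⟩) (by simp)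
      rw [this, mul_zero, zero_mul]
  · simp

section Cyclic

variable {K E : Type*} [Field K] [Field E] [Algebra K E] {ζ : E} {n : ℕ}

/-- Zeros at `ζ^(a+i+Qt)`, `i < m`, `t ≤ s`, bound the weight of words of a cyclic code. -/
theorem le_hammingNorm_of_mem_cyclicCode [DecidableEq K] (hζ : IsPrimitiveRoot ζ n) {Q : ℕ}
    (hQ : Nat.Coprime Q n) {Z : Set ℕ} {c : Fin n → K} (hcZ : c ∈ cyclicCode K ζ n Z) (hc : c ≠ 0)
    {a m s : ℕ} (hm : 1 ≤ m) (h : ∀ i < m, ∀ t ≤ s, (a + i + Q * t) % n ∈ Z) :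
    m + s + 1 ≤ hammingNorm c := by
  classical
  have hw : hammingNorm (fun j => algebraMap K E (c j)) = hammingNorm c := by
    simp [hammingNorm]
  rw [← hw]
  refine hartmannTzeng_bound hζ hQ ?_ hm (a := a) fun i hi t ht => ?_
  · intro h0
    exact hc (funext fun j => by simpa using congrFun h0 j)
  · have := hcZ _ (h i hi t ht)
    rwa [show ζ ^ ((a + i + Q * t) % n) = ζ ^ (a + i + Q * t) by
      rw [hζ.eq_orderOf, pow_mod_orderOf]] at this

theorem mem_cyclotomicCoset_self (Q n x : ℕ) : x % n ∈ cyclotomicCoset Q n x := ⟨0, by simp⟩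

/-- The BCH bound. -/
theorem le_hammingNorm_of_mem_bchCode [DecidableEq K] (hζ : IsPrimitiveRoot ζ n) {d : ℕ}
    (hd : 1 ≤ d) {c : Fin n → K} (hcZ : c ∈ bchCode K ζ n d) (hc : c ≠ 0) : d ≤ hammingNorm c := by
  obtain rfl | hd := hd.eq_or_lt
  · exact Nat.one_le_iff_ne_zero.2 (by simpa using hc)
  have := le_hammingNorm_of_mem_cyclicCode hζ (Nat.coprime_one_left n) hcZ hc (a := 1) (m := d - 1)
    (s := 0) (by omega) fun i hi t ht => by
      refine ⟨1 + i, by omega, by omega, ?_⟩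
      simpa [Nat.le_zero.1 ht] using mem_cyclotomicCoset_self _ n (1 + i)
  omega

theorem exists_mul_mem_interval {Q : ℕ} (hQ : 0 < Q) (u : ℕ) :
    ∃ v, u ≤ Q * v ∧ Q * v < u + Q := by
  refine ⟨(u + Q - 1) / Q, ?_, ?_⟩
  · have := Nat.div_add_mod (u + Q - 1) Q
    have := Nat.mod_lt (u + Q - 1) hQ
    omega
  · have := Nat.div_add_mod (u + Q - 1) Q
    omega

/-- A run of consecutive integers `x ∈ [a,b]`, none divisible by `Q`, bounds the distance. -/
theorem run_bound [DecidableEq K] (hζ : IsPrimitiveRoot ζ n) {Q : ℕ} (hQ : Nat.card K = Q)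
    {a b : ℕ} {c : Fin n → K}
    (hcZ : c ∈ intervalCode K ζ n a b) (hc : c ≠ 0) {l m : ℕ} (hal : a ≤ l) (hlb : l + m ≤ b + 1)
    (h : ∀ i < m, ¬ Q ∣ l + i) : m + 1 ≤ hammingNorm c := by
  subst hQ
  obtain rfl | hm := Nat.eq_zero_or_pos m
  · have := hammingNorm_pos_iff.2 hc
    omega
  have := le_hammingNorm_of_mem_cyclicCode hζ (Nat.coprime_one_left n) hcZ hc (a := l) (m := m)
    (s := 0) hm fun i hi t ht => by
      refine ⟨l + i, by omega, by omega, h i hi, ?_⟩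
      simpa [Nat.le_zero.1 ht] using mem_cyclotomicCoset_self _ n (l + i)
  omega

theorem not_dvd_of_between {Q v x : ℕ} (h1 : Q * v < x) (h2 : x < Q * (v + 1)) : ¬ Q ∣ x := by
  rintro ⟨w, rfl⟩
  have := lt_of_mul_lt_mul_left h1 (Nat.zero_le Q)
  have := lt_of_mul_lt_mul_left h2 (Nat.zero_le Q)
  omega

/-- A long interval contains enough full blocks of Q - 1 consecutive non-multiples of Q, spaced by
Q, for the Hartmann–Tzeng bound. In a short one the longest run free of multiples of Q contains at
least half of the interval, rounded down, or is a full block; the BCH bound then suffices. -/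
theorem distBound_le_hammingNorm [DecidableEq K] (hζ : IsPrimitiveRoot ζ n)
    {Q : ℕ} (hQ : Nat.card K = Q) (hQn : Nat.Coprime Q n) (hQ2 : 2 ≤ Q) {a b : ℕ} (ha : 1 ≤ a)
    (hab : a ≤ b) {c : Fin n → K} (hcZ : c ∈ intervalCode K ζ n a b) (hc : c ≠ 0) :
    distBound Q a b ≤ hammingNorm c := by
  -- Starting the search at a - 1 lets the first full block Qv + 1, …, Qv + Q - 1 begin at a itself
  -- when Q divides a - 1.
  obtain ⟨v, hv1, hv2⟩ := exists_mul_mem_interval (by omega : 0 < Q) (a - 1)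
  have hsucc : Q * (v + 1) = Q * v + Q := by ring
  unfold distBound
  split_ifs with hcase
  · set m := (b - a + 3) / Q with hm
    have hm2 : 2 ≤ m := (Nat.le_div_iff_mul_le (by omega)).2 hcase
    have hmQ : Q * m ≤ b - a + 3 := Nat.mul_div_le _ _
    -- Since Qv ≤ a + Q - 2, the last of the m - 1 blocks ends at most at a + Qm - 3 ≤ b; this is
    -- the origin of the 3 and the 2 in the bound.
    have := le_hammingNorm_of_mem_cyclicCode hζ hQn hcZ hc (a := Q * v + 1) (m := Q - 1)
      (s := m - 2) (by omega) fun i hi t ht => by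
        have h2 : Q * (v + t) = Q * v + Q * t := by ring
        have h3 : Q * (v + t + 1) = Q * v + Q * t + Q := by ring
        have h4 : Q * (t + 2) ≤ Q * m := Nat.mul_le_mul_left Q (by omega)
        have h5 : Q * (t + 2) = Q * t + 2 * Q := by ring
        have h6 : ¬ Q ∣ Q * v + 1 + i + Q * t :=
          not_dvd_of_between (v := v + t) (by omega) (by omega)
        refine ⟨Q * v + 1 + i + Q * t, by omega, by omega, ?_, mem_cyclotomicCoset_self _ n _⟩
        rwa [hQ]
    omega
  -- Either the whole interval avoids multiples of Q, or it contains a full block, or Qv cuts it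
  -- (possibly only at its left end) and the longer side is used.
  · by_cases h1 : b < Q * v
    · by_cases hv : v = 0
      · simp [hv] at h1
      obtain ⟨v, rfl⟩ := Nat.exists_eq_succ_of_ne_zero hv
      simp only [Nat.succ_eq_add_one] at *
      have hs : Q * (v + 1) = Q * v + Q := by ring
      have := run_bound hζ hQ hcZ hc (l := a) (m := b + 1 - a) le_rfl (by omega)
        fun i hi => not_dvd_of_between (v := v) (by omega) (by omega)
      omega
    · by_cases h2 : Q * v + Q ≤ b + 1
      · have := run_bound hζ hQ hcZ hc (l := Q * v + 1) (m := Q - 1) (by omega) (by omega)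
          fun i hi => not_dvd_of_between (v := v) (by omega) (by omega)
        omega
      · have r1 := run_bound hζ hQ hcZ hc (l := Q * v + 1) (m := b - Q * v) (by omega) (by omega)
          fun i hi => not_dvd_of_between (v := v) (by omega) (by omega)
        by_cases h3 : Q * v ≤ a
        · omega
        have hv : v ≠ 0 := by
          rintro rfl
          omega
        obtain ⟨v, rfl⟩ := Nat.exists_eq_succ_of_ne_zero hv
        simp only [Nat.succ_eq_add_one] at *
        have hs : Q * (v + 1) = Q * v + Q := by ring
        have r2 := run_bound hζ hQ hcZ hc (l := a) (m := Q * (v + 1) - a) le_rfl (by omega)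
          fun i hi => not_dvd_of_between (v := v) (by omega) (by omega)
        omega

end Cyclic

/-- Needed when the first and last coefficients coincide: the BCH distance 2δ + 1 must then cover δ
+ 1 + Δ. In the long case it comes from Q + m ≤ Qm for Q, m ≥ 2. -/
theorem distBound_le {Q δ : ℕ} (hQ : 2 ≤ Q) (hδ : 1 ≤ δ) : distBound Q (δ + 1) (2 * δ) ≤ δ := by
  unfold distBound
  have e : 2 * δ - (δ + 1) + 3 = δ + 2 := by omega
  rw [e]
  split_ifs with h
  · set m := (δ + 2) / Q with hm
    have hm2 : 2 ≤ m := (Nat.le_div_iff_mul_le (by omega)).2 h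
    have hmQ : Q * m ≤ δ + 2 := Nat.mul_div_le _ _
    have : Q + m ≤ Q * m := by nlinarith
    omega
  · omega


/-! ## Arithmetic of cyclotomic cosets of small representatives -/

section Cosets

variable {q n r M : ℕ}

/-- After reducing the exponent modulo 2r, an exponent i ≤ r leaves a positive number at most M(q^r
+ 1) < n. For i > r, multiplication by q^(2r-i) exchanges the roles of x and y and brings the
exponent below r. -/
theorem not_dvd_mul_pow_add (hr : q ^ (2 * r) ≡ 1 [MOD n]) (hr0 : 0 < r)
    (hM : M * (q ^ r + 1) < n) (hq : 0 < q) {x y : ℕ} (hx : 1 ≤ x) (hxM : x ≤ M) (hy : 1 ≤ y)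
    (hyM : y ≤ M) (j : ℕ) : ¬ n ∣ x * q ^ j + y := by
  have small : ∀ x y i, x ≤ M → 1 ≤ y → y ≤ M → i ≤ r → ¬ n ∣ x * q ^ i + y := by
    intro x y i hx hy1 hy hi hd
    have h1 : x * q ^ i ≤ M * q ^ r := Nat.mul_le_mul hx (Nat.pow_le_pow_right hq hi)
    have := Nat.le_of_dvd (by omega) hd
    have : M * (q ^ r + 1) = M * q ^ r + M := by ring
    omega
  intro hd
  have hmod : x * q ^ j + y ≡ x * q ^ (j % (2 * r)) + y [MOD n] := by
    refine Nat.ModEq.add_right y (Nat.ModEq.mul_left x ?_)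
    conv_lhs => rw [← Nat.div_add_mod j (2 * r), pow_add, pow_mul]
    simpa using (hr.pow (j / (2 * r))).mul_right (q ^ (j % (2 * r)))
  rw [hmod.dvd_iff dvd_rfl] at hd
  have hlt := Nat.mod_lt j (by omega : 0 < 2 * r)
  set i := j % (2 * r)
  by_cases hi : i ≤ r
  · exact small x y i hxM hy hyM hi hd
  · refine small y x (2 * r - i) hyM hx hxM (by omega) ?_
    have h1 : y * q ^ (2 * r - i) + x ≡ q ^ (2 * r - i) * (x * q ^ i + y) [MOD n] := by
      have e : q ^ (2 * r - i) * (x * q ^ i + y) = y * q ^ (2 * r - i) + x * q ^ (2 * r) := by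
        conv_rhs => rw [show 2 * r = (2 * r - i) + i by omega, pow_add]
        simp only [Nat.add_sub_cancel]
        ring
      rw [e]
      simpa using (hr.symm.mul_left x).add_left (y * q ^ (2 * r - i))
    rw [h1.dvd_iff dvd_rfl]
    exact hd.mul_left _

theorem not_dvd_mul_pow_add_mul_pow (hqn : Nat.Coprime n q) (hr : q ^ (2 * r) ≡ 1 [MOD n])
    (hr0 : 0 < r) (hM : M * (q ^ r + 1) < n) (hq : 0 < q) {x y : ℕ} (hx : 1 ≤ x) (hxM : x ≤ M)
    (hy : 1 ≤ y) (hyM : y ≤ M) (a b : ℕ) : ¬ n ∣ x * q ^ a + y * q ^ b := by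
  intro hd
  rcases le_total a b with h | h
  · refine not_dvd_mul_pow_add hr hr0 hM hq hy hyM hx hxM (b - a)
      ((hqn.pow_right a).dvd_of_dvd_mul_left ?_)
    rwa [mul_add, mul_left_comm, ← pow_add, Nat.add_sub_cancel' h, add_comm, mul_comm (q ^ a)]
  · refine not_dvd_mul_pow_add hr hr0 hM hq hx hxM hy hyM (a - b)
      ((hqn.pow_right b).dvd_of_dvd_mul_left ?_)
    rwa [mul_add, mul_left_comm, ← pow_add, Nat.add_sub_cancel' h, mul_comm (q ^ b)]

/-- If 2d ≤ r, both sides are below n, so the congruence is an equality, and d > 0 would make x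
divisible by q². If 2d > r, rotating by q^(2(r-d)) exchanges x and y; the small case would then give
r - d = 0, against d < r. -/
theorem eq_of_modEq_mul_pow (hr : q ^ (2 * r) ≡ 1 [MOD n])
    (hM : M * (q ^ r + 1) < n) (hq : 0 < q) {x y d : ℕ} (hxM : x ≤ M)
    (hyM : y ≤ M) (hxq : ¬ q ^ 2 ∣ x) (hyq : ¬ q ^ 2 ∣ y) (hd : d < r)
    (h : x ≡ y * (q ^ 2) ^ d [MOD n]) : x = y ∧ d = 0 := by
  have small : ∀ x y i, x ≤ M → y ≤ M → ¬ q ^ 2 ∣ x → 2 * i ≤ r → x ≡ y * (q ^ 2) ^ i [MOD n] →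
      x = y ∧ i = 0 := by
    intro x y i hx hy hxq hi h
    have h1 : y * (q ^ 2) ^ i ≤ M * q ^ r := by
      rw [← pow_mul]
      exact Nat.mul_le_mul hy (Nat.pow_le_pow_right hq hi)
    have : M * (q ^ r + 1) = M * q ^ r + M := by ring
    have hxy := h.eq_of_lt_of_lt (by omega) (by omega)
    obtain rfl | hi0 := Nat.eq_zero_or_pos i
    · simpa using hxy
    · exact absurd (hxy ▸ (dvd_pow_self (q ^ 2) hi0.ne').mul_left y) hxq
  by_cases hdr : 2 * d ≤ r
  · exact small x y d hxM hyM hxq hdr h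
  · have h1 : y ≡ x * (q ^ 2) ^ (r - d) [MOD n] := by
      refine Nat.ModEq.trans ?_ (h.symm.mul_right _)
      rw [mul_assoc, ← pow_add, Nat.add_sub_cancel' hd.le, ← pow_mul]
      simpa using hr.symm.mul_left y
    have := small y x (r - d) hyM hxM hyq (by omega) h1
    omega

/-- This says at once that the cosets of the representatives in X have r elements each and are
pairwise disjoint. -/
theorem injOn_mul_pow_mod (hqn : Nat.Coprime n q) (hr : q ^ (2 * r) ≡ 1 [MOD n])
    (hM : M * (q ^ r + 1) < n) (hq : 0 < q) {X : Finset ℕ}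
    (hX : ∀ x ∈ X, 1 ≤ x ∧ x ≤ M ∧ ¬ q ^ 2 ∣ x) :
    Set.InjOn (fun p : ℕ × ℕ => p.1 * (q ^ 2) ^ p.2 % n) (X ×ˢ Finset.range r : Finset (ℕ × ℕ)) := by
  have key : ∀ x i y j, x ∈ X → i < r → y ∈ X → j < r → i ≤ j →
      x * (q ^ 2) ^ i ≡ y * (q ^ 2) ^ j [MOD n] → x = y ∧ i = j := by
    intro x i y j hx hi hy hj hij h
    obtain ⟨-, h2, h3⟩ := hX x hx
    obtain ⟨-, h5, h6⟩ := hX y hy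
    have h' : x ≡ y * (q ^ 2) ^ (j - i) [MOD n] := by
      refine Nat.ModEq.cancel_right_of_coprime (c := (q ^ 2) ^ i)
        ((hqn.pow_right 2).pow_right i) ?_
      rwa [mul_assoc, ← pow_add, Nat.sub_add_cancel hij]
    have := eq_of_modEq_mul_pow hr hM hq h2 h5 h3 h6 (by omega) h'
    omega
  rintro ⟨x, i⟩ hp ⟨y, j⟩ hp' h
  simp only [Finset.coe_product, Finset.coe_range, Set.mem_prod, Finset.mem_coe,
    Set.mem_Iio] at hp hp'
  rcases le_total i j with hij | hij
  · obtain ⟨rfl, rfl⟩ := key x i y j hp.1 hp.2 hp'.1 hp'.2 hij h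
    rfl
  · obtain ⟨rfl, rfl⟩ := key y j x i hp'.1 hp'.2 hp.1 hp.2 hij (Nat.ModEq.symm h)
    rfl

end Cosets

/-! ### Counting the coset representatives. -/

theorem card_filter_not_dvd (Q δ : ℕ) :
    ((Finset.Icc 1 δ).filter fun x => ¬ Q ∣ x).card = δ - δ / Q := by
  have h := Finset.card_filter_add_card_filter_not (s := Finset.Icc 1 δ) (fun x => Q ∣ x)
  have h2 : ((Finset.Icc 1 δ).filter fun x => Q ∣ x).card = δ / Q :=
    Nat.Ioc_filter_dvd_card_eq_div δ Q
  simp only [Nat.card_Icc] at h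
  omega

theorem ceil_mul_one_sub_inv {Q : ℕ} (hQ : 0 < Q) (δ : ℕ) :
    ⌈(δ : ℚ) * (1 - 1 / (Q : ℚ))⌉₊ = δ - δ / Q := by
  have hQ' : (0 : ℚ) < Q := by exact_mod_cast hQ
  have e : (δ : ℚ) * (1 - 1 / Q) = δ - δ / Q := by ring
  have hle : δ / Q ≤ δ := Nat.div_le_self _ _
  have h1 : ((δ / Q : ℕ) : ℚ) ≤ δ / Q := Nat.cast_div_le
  have h2 : (δ : ℚ) / Q < (δ / Q : ℕ) + 1 := by
    rw [div_lt_iff₀ hQ']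
    exact_mod_cast Nat.lt_mul_of_div_lt (Nat.lt_succ_self _) hQ
  rw [e]
  refine le_antisymm (Nat.ceil_le.2 ?_) (Nat.le_of_lt_succ ?_)
  · push_cast [hle]
    linarith
  · have := Nat.le_ceil ((δ : ℚ) - δ / Q)
    have h3 : ((δ - δ / Q : ℕ) : ℚ) < ((⌈(δ : ℚ) - δ / Q⌉₊ + 1 : ℕ) : ℚ) := by
      push_cast [hle]
      linarith
    exact_mod_cast h3


/-! ## Dimensions and duals of cyclic codes -/

section Eval

variable {K E : Type*} [Field K] [Field E] [Algebra K E]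

/-- Evaluation `c ↦ ∑ c_j ζ^(zj)` of a word at `ζ^z`. -/
def evalMap (K : Type*) {E : Type*} [Field K] [Field E] [Algebra K E] (ζ : E) (n z : ℕ) :
    (Fin n → K) →ₗ[K] E :=
  Fintype.linearCombination K fun j : Fin n => (ζ ^ z) ^ (j : ℕ)

/-- The words vanishing at `ζ^x` for all `x ∈ X`. -/
def evalCode (K : Type*) {E : Type*} [Field K] [Field E] [Algebra K E] (ζ : E) (n : ℕ)
    (X : Finset ℕ) : Submodule K (Fin n → K) :=
  ⨅ x ∈ X, LinearMap.ker (evalMap K ζ n x)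

variable {ζ : E} {n : ℕ}

theorem evalMap_apply (z : ℕ) (c : Fin n → K) :
    evalMap K ζ n z c = ∑ j, algebraMap K E (c j) * (ζ ^ z) ^ (j : ℕ) := by
  simp [evalMap, Fintype.linearCombination_apply, Algebra.smul_def]

theorem mem_evalCode {X : Finset ℕ} {c : Fin n → K} :
    c ∈ evalCode K ζ n X ↔ ∀ x ∈ X, evalMap K ζ n x c = 0 := by
  simp [evalCode]

theorem pow_mod_eq (hζ : IsPrimitiveRoot ζ n) (z : ℕ) : ζ ^ (z % n) = ζ ^ z := by
  rw [hζ.eq_orderOf, pow_mod_orderOf]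

theorem evalMap_mod (hζ : IsPrimitiveRoot ζ n) (z : ℕ) :
    evalMap K ζ n (z % n) = evalMap K ζ n z := by
  unfold evalMap
  rw [pow_mod_eq hζ]

variable [Fintype K]

/-- The Frobenius of E over K fixes the coefficients of c and only moves the evaluation point. Hence
one zero forces zeros on its whole cyclotomic coset. -/
theorem evalMap_pow_card (z : ℕ) (c : Fin n → K) :
    evalMap K ζ n z c ^ Fintype.card K = evalMap K ζ n (z * Fintype.card K) c := by
  have := map_sum (FiniteField.frobeniusAlgHom K E)
    (fun j => algebraMap K E (c j) * (ζ ^ z) ^ (j : ℕ)) Finset.univ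
  simp only [map_mul, AlgHom.commutes, map_pow, FiniteField.coe_frobeniusAlgHom] at this
  rw [evalMap_apply, this, evalMap_apply]
  refine Finset.sum_congr rfl fun j _ => ?_
  simp only [← pow_mul]
  ring_nf

theorem evalMap_pow_card_pow (z i : ℕ) (c : Fin n → K) :
    evalMap K ζ n z c ^ Fintype.card K ^ i = evalMap K ζ n (z * Fintype.card K ^ i) c := by
  induction i with
  | zero => simp
  | succ i ih => rw [pow_succ, pow_mul, ih, evalMap_pow_card, mul_assoc]

theorem evalMap_eq_zero_of_mem_coset (hζ : IsPrimitiveRoot ζ n) {x z : ℕ}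
    (hz : z ∈ cyclotomicCoset (Nat.card K) n x) {c : Fin n → K} (h : evalMap K ζ n x c = 0) :
    evalMap K ζ n z c = 0 := by
  obtain ⟨i, rfl⟩ := hz
  rw [Nat.card_eq_fintype_card, evalMap_mod hζ, ← evalMap_pow_card_pow, h]
  exact zero_pow (pow_ne_zero _ Fintype.card_ne_zero)

theorem intervalCode_eq_evalCode (hζ : IsPrimitiveRoot ζ n) (a b : ℕ) :
    intervalCode K ζ n a b =
      evalCode K ζ n ((Finset.Icc a b).filter fun x => ¬ Nat.card K ∣ x) := by
  ext c
  rw [mem_evalCode]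
  constructor
  · intro h x hx
    simp only [Finset.mem_filter, Finset.mem_Icc] at hx
    rw [← evalMap_mod hζ, evalMap_apply]
    exact h _ ⟨x, hx.1.1, hx.1.2, hx.2, mem_cyclotomicCoset_self _ n x⟩
  · rintro h z ⟨x, h1, h2, h3, hz⟩
    rw [← evalMap_apply]
    exact evalMap_eq_zero_of_mem_coset hζ hz
      (h x (by simp only [Finset.mem_filter, Finset.mem_Icc]; exact ⟨⟨h1, h2⟩, h3⟩))

/-- A multiple Qy, with Q = |K|, lies in the coset of the smaller y, so by strong induction its zero
is already implied by the representatives not divisible by Q. -/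
theorem bchCode_eq_evalCode (hζ : IsPrimitiveRoot ζ n) (d : ℕ) :
    bchCode K ζ n (d + 1) =
      evalCode K ζ n ((Finset.Icc 1 d).filter fun x => ¬ Nat.card K ∣ x) := by
  ext c
  rw [mem_evalCode]
  constructor
  · intro h x hx
    simp only [Finset.mem_filter, Finset.mem_Icc] at hx
    rw [← evalMap_mod hζ, evalMap_apply]
    exact h _ ⟨x, hx.1.1, by omega, mem_cyclotomicCoset_self _ n x⟩
  · intro h
    have key : ∀ x, 1 ≤ x → x ≤ d → evalMap K ζ n x c = 0 := by
      intro x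
      induction x using Nat.strong_induction_on with
      | _ x ih =>
        intro hx1 hxd
        by_cases hx : Nat.card K ∣ x
        · obtain ⟨y, rfl⟩ := hx
          have hK : 1 < Nat.card K := Finite.one_lt_card
          have hy : 0 < y := by
            rcases Nat.eq_zero_or_pos y with rfl | hy
            · simp at hx1
            · exact hy
          have hlt : y < Nat.card K * y := by nlinarith
          rw [mul_comm, Nat.card_eq_fintype_card, ← evalMap_pow_card, ih y hlt hy (by omega)]
          exact zero_pow Fintype.card_ne_zero
        · exact h x (by simp only [Finset.mem_filter, Finset.mem_Icc]; exact ⟨⟨hx1, hxd⟩, hx⟩)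
    rintro z ⟨x, h1, h2, hz⟩
    rw [← evalMap_apply]
    exact evalMap_eq_zero_of_mem_coset hζ hz (key x h1 (by omega))

/-- All values of the evaluation are roots of X^(|K|^r) - X, so there are at most |K|^r of them.
This avoids naming the intermediate field they lie in. -/
theorem finrank_range_evalMap_le (hζ : IsPrimitiveRoot ζ n) {r : ℕ} (hr0 : r ≠ 0)
    (hr : Fintype.card K ^ r ≡ 1 [MOD n]) (z : ℕ) :
    Module.finrank K (LinearMap.range (evalMap K ζ n z)) ≤ r := by
  classical
  have hK : 1 < Fintype.card K := Fintype.one_lt_card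
  set p : E[X] := X ^ Fintype.card K ^ r - X with hp
  have hp0 : p ≠ 0 := FiniteField.X_pow_card_pow_sub_X_ne_zero E hr0 hK
  have hsub : (LinearMap.range (evalMap K ζ n z) : Set E) ⊆ p.roots.toFinset := by
    rintro _ ⟨c, rfl⟩
    have h1 : evalMap K ζ n z c ^ Fintype.card K ^ r = evalMap K ζ n z c := by
      rw [evalMap_pow_card_pow, ← evalMap_mod hζ, hr.mul_left z, mul_one, evalMap_mod hζ]
    simpa [hp, h1] using hp0
  have hcard : Nat.card (LinearMap.range (evalMap K ζ n z)) ≤ Fintype.card K ^ r := by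
    calc Nat.card (LinearMap.range (evalMap K ζ n z))
        ≤ (p.roots.toFinset : Set E).ncard := Set.ncard_le_ncard hsub
      _ ≤ p.roots.card := by
          rw [Set.ncard_coe_finset]; exact Multiset.toFinset_card_le _
      _ ≤ p.natDegree := p.card_roots'
      _ = Fintype.card K ^ r := FiniteField.X_pow_card_pow_sub_X_natDegree_eq E hr0 hK
  rw [Module.natCard_eq_pow_finrank (K := K), Nat.card_eq_fintype_card] at hcard
  exact (Nat.pow_le_pow_iff_right hK).1 hcard

theorem le_finrank_evalCode (hζ : IsPrimitiveRoot ζ n) {r : ℕ} (hr0 : r ≠ 0)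
    (hr : Fintype.card K ^ r ≡ 1 [MOD n]) (X : Finset ℕ) :
    n ≤ Module.finrank K (evalCode K ζ n X) + r * X.card := by
  set f : (Fin n → K) →ₗ[K] (x : X) → LinearMap.range (evalMap K ζ n x) :=
    LinearMap.pi fun x => (evalMap K ζ n x).rangeRestrict with hf
  have hker : LinearMap.ker f = evalCode K ζ n X := by
    ext c
    rw [LinearMap.mem_ker, mem_evalCode, funext_iff]
    simp [hf, Subtype.ext_iff]
  have h1 := f.finrank_range_add_finrank_ker
  have h2 : Module.finrank K (LinearMap.range f) ≤ r * X.card := by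
    calc _ ≤ _ := Submodule.finrank_le _
      _ = ∑ x : X, Module.finrank K (LinearMap.range (evalMap K ζ n x)) :=
        Module.finrank_pi_fintype K
      _ ≤ ∑ x : X, r := Finset.sum_le_sum fun x _ => finrank_range_evalMap_le hζ hr0 hr x
      _ = r * X.card := by simp [mul_comm]
  rw [hker, Module.finrank_fin_fun] at h1
  omega

variable {r : ℕ} {X : Finset ℕ}

/-- The union of the cyclotomic cosets of the elements of `X`, for cosets of size `r`. -/
def cosetUnion (Q n r : ℕ) (X : Finset ℕ) : Finset ℕ :=
  (X ×ˢ Finset.range r).image fun p => p.1 * Q ^ p.2 % n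

theorem card_cosetUnion {Q : ℕ} (hinj : Set.InjOn (fun p : ℕ × ℕ => p.1 * Q ^ p.2 % n)
    (X ×ˢ Finset.range r : Finset (ℕ × ℕ))) : (cosetUnion Q n r X).card = r * X.card := by
  rw [cosetUnion, Finset.card_image_of_injOn hinj, Finset.card_product, Finset.card_range, mul_comm]

theorem evalMap_eq_zero_of_mem_cosetUnion (hζ : IsPrimitiveRoot ζ n) {c : Fin n → K}
    (hc : c ∈ evalCode K ζ n X) {z : ℕ} (hz : z ∈ cosetUnion (Fintype.card K) n r X) :
    evalMap K ζ n z c = 0 := by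
  simp only [cosetUnion, Finset.mem_image, Finset.mem_product, Prod.exists] at hz
  obtain ⟨x, i, ⟨hx, -⟩, rfl⟩ := hz
  exact evalMap_eq_zero_of_mem_coset hζ ⟨i, by rw [Nat.card_eq_fintype_card]⟩
    (mem_evalCode.1 hc x hx)

theorem cosetUnion_lt {Q : ℕ} (hn : 0 < n) {z : ℕ} (hz : z ∈ cosetUnion Q n r X) : z < n := by
  simp only [cosetUnion, Finset.mem_image] at hz
  obtain ⟨p, -, rfl⟩ := hz
  exact Nat.mod_lt _ hn

/-- A codeword vanishing on the last n - |P| positions is a polynomial of degree below |P| with the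
|P| distinct roots ζ^z, z ∈ P. Restriction to those last positions is thus injective on the code. -/
theorem finrank_evalCode_le (hζ : IsPrimitiveRoot ζ n) (hn : 0 < n)
    (hinj : Set.InjOn (fun p : ℕ × ℕ => p.1 * Fintype.card K ^ p.2 % n)
      (X ×ˢ Finset.range r : Finset (ℕ × ℕ))) :
    Module.finrank K (evalCode K ζ n X) + r * X.card ≤ n := by
  classical
  rw [← card_cosetUnion hinj]
  set P := cosetUnion (Fintype.card K) n r X with hP
  have hPn : P.card ≤ n := by
    have : P ⊆ Finset.range n := fun z hz => Finset.mem_range.2 (cosetUnion_lt hn hz)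
    simpa using Finset.card_le_card this
  let f : evalCode K ζ n X →ₗ[K] (Fin (n - P.card) → K) :=
    (LinearMap.funLeft K K fun j : Fin (n - P.card) =>
      (⟨P.card + j, by omega⟩ : Fin n)) ∘ₗ (evalCode K ζ n X).subtype
  have hf : Function.Injective f := by
    rw [injective_iff_map_eq_zero]
    rintro ⟨c, hc⟩ h0
    have hc0 : ∀ j : Fin n, P.card ≤ j → c j = 0 := by
      intro j hj
      have := congrFun h0 ⟨j - P.card, by omega⟩
      simpa [f, LinearMap.funLeft_apply, Nat.add_sub_cancel' hj] using this
    set g : E[X] := ∑ j : Fin n, monomial (j : ℕ) (algebraMap K E (c j)) with hg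
    have hcoeff : ∀ j : Fin n, g.coeff j = algebraMap K E (c j) := by
      intro j
      simp only [hg, finsetSum_coeff, coeff_monomial, Fin.val_inj]
      simp
    have hg0 : g = 0 := by
      by_cases hP0 : P.card = 0
      · rw [hg]
        exact Finset.sum_eq_zero fun j _ => by rw [hc0 j (by omega)]; simp
      have hdeg : g.natDegree < P.card := by
        refine lt_of_le_of_lt (natDegree_sum_le_of_forall_le (n := P.card - 1) _ _ fun j _ => ?_)
          (by omega)
        by_cases hj : P.card ≤ j
        · simp [hc0 j hj]
        · exact (natDegree_monomial_le _).trans (by omega)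
      refine eq_zero_of_natDegree_lt_card_of_eval_eq_zero g (ι := P)
        (f := fun z => ζ ^ (z : ℕ)) ?_ ?_ (by simpa using hdeg)
      · intro z w h
        exact Subtype.ext (hζ.pow_inj (cosetUnion_lt hn z.2) (cosetUnion_lt hn w.2) h)
      · intro z
        have := evalMap_eq_zero_of_mem_cosetUnion hζ hc z.2
        rw [evalMap_apply] at this
        simpa [hg, eval_finsetSum, eval_monomial] using this
    refine Subtype.ext (funext fun j => ?_)
    have := hcoeff j
    rw [hg0, coeff_zero] at this
    simpa using this.symm
  have := LinearMap.finrank_le_finrank_of_injective hf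
  rw [Module.finrank_fin_fun] at this
  omega

theorem finrank_evalCode (hζ : IsPrimitiveRoot ζ n) (hn : 0 < n) (hr0 : r ≠ 0)
    (hr : Fintype.card K ^ r ≡ 1 [MOD n])
    (hinj : Set.InjOn (fun p : ℕ × ℕ => p.1 * Fintype.card K ^ p.2 % n)
      (X ×ˢ Finset.range r : Finset (ℕ × ℕ))) :
    Module.finrank K (evalCode K ζ n X) + r * X.card = n :=
  le_antisymm (finrank_evalCode_le hζ hn hinj) (le_finrank_evalCode hζ hr0 hr X)

/-! ### Duals of cyclic codes over the extension field. -/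

theorem linearIndependent_powers (hζ : IsPrimitiveRoot ζ n) :
    LinearIndependent E fun z : Fin n => fun j : Fin n => (ζ ^ (z : ℕ)) ^ (j : ℕ) := by
  have : (Matrix.vandermonde fun z : Fin n => ζ ^ (z : ℕ)).det ≠ 0 :=
    Matrix.det_vandermonde_ne_zero_iff.2 fun a b h => Fin.ext (hζ.pow_inj a.2 b.2 h)
  exact Matrix.linearIndependent_rows_of_det_ne_zero this

/-- A word orthogonal to a cyclic code is a combination of the words `(ζ^(zj))_j` with `z` in the
defining set. -/
theorem mem_span_of_orthogonal (hζ : IsPrimitiveRoot ζ n) (hn : 0 < n) (hr0 : r ≠ 0)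
    (hr : Fintype.card K ^ r ≡ 1 [MOD n])
    (hinj : Set.InjOn (fun p : ℕ × ℕ => p.1 * Fintype.card K ^ p.2 % n)
      (X ×ˢ Finset.range r : Finset (ℕ × ℕ))) {u : Fin n → K}
    (hu : ∀ c ∈ evalCode K ζ n X, ∑ j, u j * c j = 0) :
    (fun j => algebraMap K E (u j)) ∈ Submodule.span E
      ((fun z : ℕ => fun j : Fin n => (ζ ^ z) ^ (j : ℕ)) '' cosetUnion (Fintype.card K) n r X) := by
  classical
  have hdim := finrank_evalCode hζ hn hr0 hr hinj
  have hPcard := card_cosetUnion hinj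
  set C := evalCode K ζ n X with hC
  set P := cosetUnion (Fintype.card K) n r X with hP
  obtain ⟨D, hD⟩ := C.exists_isCompl
  have hDdim : Module.finrank K D = P.card := by
    have := Submodule.finrank_add_eq_of_isCompl hD
    rw [Module.finrank_fin_fun] at this
    omega
  let b := Module.finBasis K D
  -- `A` is the annihilator of the code over E. Pairing with a basis of the complement `D` embeds it
  -- in a space of dimension |P|, while the words (ζ^(zj))_j, z ∈ P, span a |P|-dimensional subspace
  -- of `A`; the two therefore agree.
  let A : Submodule E (Fin n → E) :=
    { carrier := {f | ∀ c ∈ C, ∑ j, f j * algebraMap K E (c j) = 0}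
      zero_mem' := by intro c _; simp
      add_mem' := by
        intro f g hf hg c hc
        simp [add_mul, Finset.sum_add_distrib, hf c hc, hg c hc]
      smul_mem' := by
        intro a f hf c hc
        simp [mul_assoc, ← Finset.mul_sum, hf c hc] }
  let g : A →ₗ[E] (Fin (Module.finrank K D) → E) :=
    { toFun := fun f i => ∑ j, f.1 j * algebraMap K E ((b i : Fin n → K) j)
      map_add' := by
        intro f h
        ext i
        simp [add_mul, Finset.sum_add_distrib]
      map_smul' := by
        intro a f
        ext i
        simp [mul_assoc, Finset.mul_sum] }
  have hg : Function.Injective g := by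
    rw [injective_iff_map_eq_zero]
    rintro ⟨f, hf⟩ h0
    let φ : (Fin n → K) →ₗ[K] E := Fintype.linearCombination K f
    have hφ : ∀ c, φ c = ∑ j, f j * algebraMap K E (c j) := by
      intro c
      simp [φ, Fintype.linearCombination_apply, Algebra.smul_def, mul_comm]
    have hφC : C ≤ LinearMap.ker φ := fun c hc => by
      rw [LinearMap.mem_ker, hφ]; exact hf c hc
    have hφD : D ≤ LinearMap.ker φ := by
      have : φ ∘ₗ D.subtype = 0 := b.ext fun i => by
        simp only [LinearMap.comp_apply, Submodule.subtype_apply, hφ, LinearMap.zero_apply]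
        exact congrFun h0 i
      intro d hd
      exact LinearMap.congr_fun this ⟨d, hd⟩
    have htop : LinearMap.ker φ = ⊤ := by
      rw [eq_top_iff, ← hD.sup_eq_top]
      exact sup_le hφC hφD
    refine Subtype.ext (funext fun j => ?_)
    have : φ (Pi.single j 1) = 0 := by
      rw [← LinearMap.mem_ker, htop]; trivial
    simpa [φ] using this
  have hAdim : Module.finrank E A ≤ P.card := by
    have := LinearMap.finrank_le_finrank_of_injective hg
    rwa [Module.finrank_fin_fun, hDdim] at this
  set S := Submodule.span E ((fun z : ℕ => fun j : Fin n => (ζ ^ z) ^ (j : ℕ)) '' (P : Set ℕ))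
    with hS
  have hSA : S ≤ A := by
    rw [hS, Submodule.span_le]
    rintro _ ⟨z, hz, rfl⟩ c hc
    have := evalMap_eq_zero_of_mem_cosetUnion hζ hc hz
    rw [evalMap_apply] at this
    simpa [mul_comm] using this
  have hSdim : Module.finrank E S = P.card := by
    have hli : LinearIndependent E fun z : P => fun j : Fin n => (ζ ^ (z : ℕ)) ^ (j : ℕ) :=
      (linearIndependent_powers hζ).comp (fun z : P => (⟨z, cosetUnion_lt hn z.2⟩ : Fin n))
        fun z w h => Subtype.ext (by simpa using h)
    have := finrank_span_eq_card hli
    rw [Fintype.card_coe] at this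
    rw [← this, hS, Set.image_eq_range]
    rfl
  rw [Submodule.eq_of_le_of_finrank_le hSA (by omega)]
  intro c hc
  have := congrArg (algebraMap K E) (hu c hc)
  simpa using this

/-- Hermitian orthogonality of the duals of cyclic codes. -/
theorem hermitian_orthogonal (hζ : IsPrimitiveRoot ζ n) (hn : 0 < n) (hr0 : r ≠ 0)
    (hr : Fintype.card K ^ r ≡ 1 [MOD n])
    (hinj : Set.InjOn (fun p : ℕ × ℕ => p.1 * Fintype.card K ^ p.2 % n)
      (X ×ˢ Finset.range r : Finset (ℕ × ℕ))) {q : ℕ} (φ : E →+* E) (hφ : ∀ y, φ y = y ^ q)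
    (hdvd : ∀ z ∈ cosetUnion (Fintype.card K) n r X, ∀ w ∈ cosetUnion (Fintype.card K) n r X,
      ¬ n ∣ z + q * w) {u v : Fin n → K}
    (hu : ∀ c ∈ evalCode K ζ n X, ∑ j, u j * c j = 0)
    (hv : ∀ c ∈ evalCode K ζ n X, ∑ j, v j * c j = 0) : ∑ j, u j * v j ^ q = 0 := by
  -- The form is additive in both arguments and `φ`-semilinear in the second, so it suffices to pair
  -- spanning words. That gives the geometric sum of ζ^(z+qw), a nontrivial n-th root of unity by
  -- `hdvd`, hence zero.
  have key : ∀ f ∈ Submodule.span E ((fun z : ℕ => fun j : Fin n => (ζ ^ z) ^ (j : ℕ)) ''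
      cosetUnion (Fintype.card K) n r X), ∀ g ∈ Submodule.span E
      ((fun z : ℕ => fun j : Fin n => (ζ ^ z) ^ (j : ℕ)) '' cosetUnion (Fintype.card K) n r X),
      ∑ j, f j * φ (g j) = 0 := by
    intro f hf g hg
    induction hf using Submodule.span_induction with
    | mem f hf =>
      obtain ⟨z, hz, rfl⟩ := hf
      induction hg using Submodule.span_induction with
      | mem g hg =>
        obtain ⟨w, hw, rfl⟩ := hg
        have h1 : ζ ^ (z + q * w) ≠ 1 := fun h => hdvd z hz w hw (hζ.dvd_of_pow_eq_one _ h)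
        have h2 : (ζ ^ (z + q * w)) ^ n = 1 := by
          rw [pow_right_comm, hζ.pow_eq_one, one_pow]
        have h3 := mul_neg_geom_sum (ζ ^ (z + q * w)) n
        rw [h2, sub_self, mul_eq_zero, or_iff_right (sub_ne_zero.2 h1.symm),
          ← Fin.sum_univ_eq_sum_range (fun j => (ζ ^ (z + q * w)) ^ j)] at h3
        rw [← h3]
        refine Finset.sum_congr rfl fun j _ => ?_
        rw [hφ]
        ring
      | zero => simp
      | add g h _ _ hg hh => simp [mul_add, Finset.sum_add_distrib, hg, hh]
      | smul a g _ hg =>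
        simp only [Pi.smul_apply, smul_eq_mul, map_mul, mul_left_comm _ (φ a)]
        rw [← Finset.mul_sum, hg, mul_zero]
    | zero => simp
    | add f h _ _ hf hh => simp [add_mul, Finset.sum_add_distrib, hf, hh]
    | smul a f _ hf =>
      simp only [Pi.smul_apply, smul_eq_mul, mul_assoc]
      rw [← Finset.mul_sum, hf, mul_zero]
  have := key _ (mem_span_of_orthogonal hζ hn hr0 hr hinj hu) _
    (mem_span_of_orthogonal hζ hn hr0 hr hinj hv)
  refine (algebraMap K E).injective ?_
  simpa [hφ] using this

end Eval

/-! ## Parity check matrices -/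

section ParityCheck

variable {K : Type*} [Field K] {n : ℕ}

theorem finrank_ker_mulVecLin {ι : Type*} [Fintype ι] (H : Matrix ι (Fin n) K) :
    H.rank + Module.finrank K (LinearMap.ker H.mulVecLin) = n := by
  have := H.mulVecLin.finrank_range_add_finrank_ker
  rwa [Module.finrank_fin_fun] at this

theorem ker_mulVecLin_eq {ι : Type*} [Fintype ι] {H : Matrix ι (Fin n) K}
    {C : Submodule K (Fin n → K)} (h : ∀ v, v ∈ C ↔ H.mulVec v = 0) :
    LinearMap.ker H.mulVecLin = C := by
  ext v
  rw [h, LinearMap.mem_ker, Matrix.mulVecLin_apply]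

/-- Rank–nullity: the rank equals the number of rows, so the rows are independent. -/
theorem isParityCheck_of_finrank {ι : Type*} [Fintype ι] {H : Matrix ι (Fin n) K}
    {C : Submodule K (Fin n → K)} (h : ∀ v, v ∈ C ↔ H.mulVec v = 0)
    (hk : Module.finrank K C + Fintype.card ι = n) : IsParityCheck H C := by
  refine ⟨?_, h⟩
  have := finrank_ker_mulVecLin H
  rw [ker_mulVecLin_eq h] at this
  rw [linearIndependent_iff_card_eq_finrank_span, Set.finrank]
  have h2 := H.rank_eq_finrank_span_row
  change _ = Module.finrank K (Submodule.span K (Set.range H)) at h2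
  change _ = Module.finrank K (Submodule.span K (Set.range H))
  omega

theorem exists_isParityCheck (C : Submodule K (Fin n → K)) {k : ℕ}
    (hk : Module.finrank K C + k = n) : ∃ H : Matrix (Fin k) (Fin n) K, IsParityCheck H C := by
  have hq : Module.finrank K ((Fin n → K) ⧸ C) = k := by
    have := C.finrank_quotient_add_finrank
    rw [Module.finrank_fin_fun] at this
    omega
  let e : ((Fin n → K) ⧸ C) ≃ₗ[K] (Fin k → K) := LinearEquiv.ofFinrankEq _ _ (by simp [hq])
  refine ⟨LinearMap.toMatrix' (e.toLinearMap ∘ₗ C.mkQ), isParityCheck_of_finrank (fun v => ?_)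
    (by simpa using hk)⟩
  rw [← Matrix.toLin'_apply, Matrix.toLin'_toMatrix']
  simp

theorem IsParityCheck.fromRows {k m : ℕ} {H₀ : Matrix (Fin k) (Fin n) K}
    {H₁ : Matrix (Fin m) (Fin n) K} {C₀ C₁ C : Submodule K (Fin n → K)} (h₀ : IsParityCheck H₀ C₀)
    (h₁ : IsParityCheck H₁ C₁) (hC : C = C₀ ⊓ C₁) (hk : Module.finrank K C + (k + m) = n) :
    IsParityCheck (Matrix.fromRows H₀ H₁) C := by
  refine isParityCheck_of_finrank (fun v => ?_) (by simpa using hk)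
  rw [hC, Submodule.mem_inf, h₀.2, h₁.2, Matrix.fromRows_mulVec, funext_iff, funext_iff,
    funext_iff, Sum.forall]
  simp

/-- The rows of a parity check matrix are orthogonal to the code. -/
theorem IsParityCheck.row_orthogonal {ι : Type*} {H : Matrix ι (Fin n) K}
    {C : Submodule K (Fin n → K)} (hH : IsParityCheck H C) (i : ι) :
    ∀ c ∈ C, ∑ j, H i j * c j = 0 := fun c hc => congrFun ((hH.2 c).1 hc) i

/-- A matrix with linearly independent rows has a right inverse. -/
theorem exists_right_inverse {ι : Type*} [Fintype ι] [DecidableEq ι] {H : Matrix ι (Fin n) K}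
    (hH : LinearIndependent K fun i => H i) : ∃ B : Matrix (Fin n) ι K, H * B = 1 := by
  rw [← Matrix.mulVec_surjective_iff_exists_right_inverse]
  have : LinearMap.range H.mulVecLin = ⊤ := by
    refine Submodule.eq_top_of_finrank_eq ?_
    rw [Module.finrank_fintype_fun_eq_card]
    exact LinearIndependent.rank_matrix hH
  exact LinearMap.range_eq_top.1 this

end ParityCheck


/-! ## Laurent-polynomial valued inner products -/

section Laurent

open LaurentPolynomial (T invert)

/-- Coefficientwise application of a ring homomorphism to Laurent polynomials. -/
noncomputable def laurentMap {R S : Type*} [Semiring R] [Semiring S] (σ : R →+* S) :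
    LaurentPolynomial R →+* LaurentPolynomial S := AddMonoidAlgebra.mapRingHom ℤ σ

theorem coeff_laurentMap {R S : Type*} [Semiring R] [Semiring S] (σ : R →+* S)
    (f : LaurentPolynomial R) (m : ℤ) : (laurentMap σ f).coeff m = σ (f.coeff m) := by
  simp [laurentMap]

theorem laurentMap_toLaurent {R S : Type*} [Semiring R] [Semiring S] (σ : R →+* S) (p : R[X]) :
    laurentMap σ (toLaurent p) = toLaurent (p.map σ) := by
  induction p using Polynomial.induction_on' with
  | add p q hp hq => simp [hp, hq]
  | monomial k a =>
    rw [← C_mul_X_pow_eq_monomial, map_mul, map_mul, Polynomial.map_mul, map_mul]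
    simp only [toLaurent_C, map_pow, toLaurent_X, Polynomial.map_C, Polynomial.map_pow, map_X]
    congr 1
    · exact LaurentPolynomial.ext fun m => by
        rw [coeff_laurentMap, LaurentPolynomial.C_apply, LaurentPolynomial.C_apply]
        split_ifs <;> simp
    · congr 1
      exact LaurentPolynomial.ext fun m => by
        rw [coeff_laurentMap, LaurentPolynomial.T_apply, LaurentPolynomial.T_apply]
        split_ifs <;> simp

theorem laurentMap_C {R S : Type*} [Semiring R] [Semiring S] (σ : R →+* S) (a : R) :
    laurentMap σ (LaurentPolynomial.C a) = LaurentPolynomial.C (σ a) := by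
  rw [← toLaurent_C, laurentMap_toLaurent, Polynomial.map_C, toLaurent_C]

theorem laurentMap_invert {R S : Type*} [CommSemiring R] [CommSemiring S] (σ : R →+* S)
    (f : LaurentPolynomial R) : laurentMap σ (invert f) = invert (laurentMap σ f) :=
  LaurentPolynomial.ext fun m => by
    simp only [coeff_laurentMap, LaurentPolynomial.invert_apply]

theorem laurentMap_injective {R S : Type*} [Semiring R] [Semiring S] {σ : R →+* S}
    (hσ : Function.Injective σ) : Function.Injective (laurentMap σ) := fun f g h =>
  LaurentPolynomial.ext fun m => hσ <| by rw [← coeff_laurentMap, h, coeff_laurentMap]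

theorem coeff_T_mul {R : Type*} [Semiring R] (k m : ℤ) (f : LaurentPolynomial R) :
    (T k * f).coeff m = f.coeff (m - k) := by
  rw [T, AddMonoidAlgebra.coeff_single_mul_eq_mul_coeff (m - k) (fun _ _ => by omega), one_mul]

theorem coeff_C_mul' {R : Type*} [Semiring R] (a : R) (m : ℤ) (f : LaurentPolynomial R) :
    (LaurentPolynomial.C a * f).coeff m = a * f.coeff m := by
  rw [← LaurentPolynomial.single_eq_C,
    AddMonoidAlgebra.coeff_single_mul_eq_mul_coeff m (fun _ _ => by omega)]

variable {K : Type*} [Field K] {n : ℕ}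

theorem coeff_toLaurent_natCast (p : K[X]) (i : ℕ) : (toLaurent p).coeff (i : ℤ) = p.coeff i := by
  induction p using Polynomial.induction_on' with
  | add p q hp hq => simp_all
  | monomial k a =>
    rw [← C_mul_X_pow_eq_monomial, toLaurent_C_mul_eq, toLaurent_X_pow, coeff_C_mul',
      LaurentPolynomial.T_apply, coeff_C_mul_X_pow]
    simp [eq_comm]

theorem coeff_zero_mul_invert (p f : K[X]) :
    (toLaurent p * invert (toLaurent f)).coeff 0 = p.sum fun i a => a * f.coeff i := by
  induction p using Polynomial.induction_on' with
  | add p q hp hq =>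
    rw [map_add, add_mul, Polynomial.sum_add_index _ _ _ (fun i => by simp) (fun i x y => by ring),
      ← hp, ← hq]
    rfl
  | monomial k a =>
    rw [Polynomial.sum_monomial_index _ _ (by simp), ← C_mul_X_pow_eq_monomial, toLaurent_C_mul_eq,
      toLaurent_X_pow, mul_assoc, coeff_C_mul', coeff_T_mul, LaurentPolynomial.invert_apply]
    rw [show -(0 - (k : ℤ)) = k by ring, coeff_toLaurent_natCast]

/-- The inner product `u(D) · σ(v)(1/D)`. -/
noncomputable def laurentInner (σ : K →+* K) (u v : Fin n → K[X]) : LaurentPolynomial K :=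
  ∑ j, toLaurent (u j) * invert (toLaurent ((v j).map σ))

variable (σ : K →+* K)

theorem convInner_eq_coeff (u v : Fin n → K[X]) :
    convInner σ u v = (laurentInner σ u v).coeff 0 := by
  have : ∀ s : Finset (Fin n), (∑ j ∈ s, toLaurent (u j) * invert (toLaurent ((v j).map σ))).coeff 0
      = ∑ j ∈ s, (toLaurent (u j) * invert (toLaurent ((v j).map σ))).coeff 0 := by
    classical
    intro s
    induction s using Finset.induction_on with
    | empty => rfl
    | insert a s ha ih => rw [Finset.sum_insert ha, Finset.sum_insert ha, ← ih]; rfl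
  rw [laurentInner, this, convInner]
  refine Finset.sum_congr rfl fun j _ => ?_
  rw [coeff_zero_mul_invert]
  simp only [coeff_map]

theorem laurentInner_smul_left (p : K[X]) (u v : Fin n → K[X]) :
    laurentInner σ (p • u) v = toLaurent p * laurentInner σ u v := by
  simp [laurentInner, Finset.mul_sum, mul_assoc]

theorem laurentInner_smul_right (p : K[X]) (u v : Fin n → K[X]) :
    laurentInner σ u (p • v) = invert (toLaurent (p.map σ)) * laurentInner σ u v := by
  simp [laurentInner, Finset.mul_sum, mul_left_comm]

theorem laurentInner_add_right (u v w : Fin n → K[X]) :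
    laurentInner σ u (v + w) = laurentInner σ u v + laurentInner σ u w := by
  simp [laurentInner, mul_add, Finset.sum_add_distrib]

theorem laurentInner_zero_right (u : Fin n → K[X]) : laurentInner σ u 0 = 0 := by
  simp [laurentInner]

/-- `convInner` is the constant coefficient of the Laurent product. Shifting u reaches its
coefficients of nonpositive index, and shifting v inside C those of nonnegative index, so
orthogonality to all shifts kills the entire product. -/
theorem mem_convDual_iff {C : Submodule K[X] (Fin n → K[X])} {u : Fin n → K[X]} :
    u ∈ convDual σ C ↔ ∀ v ∈ C, laurentInner σ u v = 0 := by
  constructor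
  · intro hu v hv
    refine LaurentPolynomial.ext fun m => ?_
    rw [AddMonoidAlgebra.coeff_zero, Finsupp.zero_apply]
    obtain ⟨k, rfl | rfl⟩ := m.eq_nat_or_neg
    · have := hu 1 (X ^ k • v) (C.smul_mem _ hv)
      rw [convInner_eq_coeff, one_smul, laurentInner_smul_right, Polynomial.map_pow, map_X,
        toLaurent_X_pow, LaurentPolynomial.invert_T, coeff_T_mul] at this
      simpa using this
    · have := hu (X ^ k) v hv
      rw [convInner_eq_coeff, laurentInner_smul_left, toLaurent_X_pow, coeff_T_mul] at this
      simpa using this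
  · intro h p v hv
    rw [convInner_eq_coeff, laurentInner_smul_left, h v hv, mul_zero]
    rfl

theorem laurentInner_span {S : Set (Fin n → K[X])} {u : Fin n → K[X]}
    (h : ∀ v ∈ S, laurentInner σ u v = 0) {v : Fin n → K[X]} (hv : v ∈ Submodule.span K[X] S) :
    laurentInner σ u v = 0 := by
  induction hv using Submodule.span_induction with
  | mem v hv => exact h v hv
  | zero => exact laurentInner_zero_right σ u
  | add v w _ _ hv hw => rw [laurentInner_add_right, hv, hw, add_zero]
  | smul p v _ hv => rw [laurentInner_smul_right, hv, mul_zero]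

theorem mem_convDual_rowModule_iff {k : ℕ} {G : Matrix (Fin k) (Fin n) K[X]} {u : Fin n → K[X]} :
    u ∈ convDual σ (rowModule G) ↔ ∀ i, laurentInner σ u (G i) = 0 := by
  rw [mem_convDual_iff]
  refine ⟨fun h i => h _ (Submodule.subset_span ⟨i, rfl⟩), fun h v hv => ?_⟩
  refine laurentInner_span σ ?_ hv
  rintro _ ⟨i, rfl⟩
  exact h i

/-- The scalar product of a constant word with a polynomial word. -/
noncomputable def constDot (h : Fin n → K) (u : Fin n → K[X]) : K[X] := ∑ j, C (h j) * u j

theorem coeff_constDot (h : Fin n → K) (u : Fin n → K[X]) (m : ℕ) :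
    (constDot h u).coeff m = ∑ j, h j * (u j).coeff m := by
  simp [constDot, finsetSum_coeff, coeff_C_mul]

/-- The inner product with a word `a + Db`, for a homomorphism `σ`. -/
theorem laurentInner_linear_right (u : Fin n → K[X]) (a b : Fin n → K) :
    laurentInner σ u (fun j => C (a j) + X * C (b j)) =
      T (-1) * toLaurent (X * constDot (fun j => σ (a j)) u + constDot (fun j => σ (b j)) u) := by
  have hT : (T (-1) * T 1 : LaurentPolynomial K) = 1 := by
    rw [← LaurentPolynomial.T_add]; simp
  simp only [laurentInner, constDot, map_add, map_mul, map_sum, toLaurent_X, mul_add, ← mul_assoc,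
    hT, one_mul, Finset.mul_sum, ← Finset.sum_add_distrib, Polynomial.map_add, Polynomial.map_mul,
    Polynomial.map_C, map_X, toLaurent_C, LaurentPolynomial.invert_C, LaurentPolynomial.invert_T]
  refine Finset.sum_congr rfl fun j _ => ?_
  ring

theorem laurentInner_linear_right_eq_zero_iff (u : Fin n → K[X]) (a b : Fin n → K) :
    laurentInner σ u (fun j => C (a j) + X * C (b j)) = 0 ↔
      X * constDot (fun j => σ (a j)) u + constDot (fun j => σ (b j)) u = 0 := by
  rw [laurentInner_linear_right, (LaurentPolynomial.isUnit_T (-1)).mul_right_eq_zero,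
    toLaurent_eq_zero]

/-- Symmetry of the inner product up to conjugation and inversion. -/
theorem laurentInner_swap {τ : K →+* K} (hτ : ∀ x, τ (σ x) = x) (u v : Fin n → K[X]) :
    laurentMap τ (invert (laurentInner σ u v)) = laurentInner τ v u := by
  have h : τ.comp σ = RingHom.id K := RingHom.ext hτ
  simp only [laurentInner, map_sum, map_mul, laurentMap_invert, laurentMap_toLaurent,
    Polynomial.map_map, h, Polynomial.map_id, LaurentPolynomial.involutive_invert _]
  exact Finset.sum_congr rfl fun j _ => mul_comm _ _

end Laurent


/-! ## The convolutional code dual to `H₀ + D H̃₁` -/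

section UnitMemory

variable {K : Type*} [Field K] {n : ℕ}

/-- The word of polynomials that is constant in `D`. -/
noncomputable def constWord (c : Fin n → K) : Fin n → K[X] := fun j => C (c j)

/-- The coefficient of `D^m` of a polynomial word. -/
def coeffWord (u : Fin n → K[X]) (m : ℕ) : Fin n → K := fun j => (u j).coeff m

theorem constDot_sub (h : Fin n → K) (u v : Fin n → K[X]) :
    constDot h (u - v) = constDot h u - constDot h v := by
  simp [constDot, mul_sub]

theorem constDot_smul (h : Fin n → K) (p : K[X]) (u : Fin n → K[X]) :
    constDot h (p • u) = p * constDot h u := by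
  simp [constDot, Finset.mul_sum, mul_left_comm]

theorem constDot_sum {ι : Type*} (s : Finset ι) (h : Fin n → K) (u : ι → Fin n → K[X]) :
    constDot h (∑ i ∈ s, u i) = ∑ i ∈ s, constDot h (u i) := by
  simp only [constDot, Finset.sum_apply, Finset.mul_sum]
  exact Finset.sum_comm

theorem constDot_linear (h a b : Fin n → K) :
    constDot h (fun j => C (a j) + X * C (b j)) =
      C (∑ j, h j * a j) + X * C (∑ j, h j * b j) := by
  simp only [constDot, mul_add, Finset.sum_add_distrib, map_sum, map_mul, Finset.mul_sum]
  congr 1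
  exact Finset.sum_congr rfl fun j _ => by ring

theorem constDot_constWord (h c : Fin n → K) :
    constDot h (constWord c) = C (∑ j, h j * c j) := by
  simp [constDot, constWord]

theorem exists_natDegree_lt (w : Fin n → K[X]) : ∃ L, ∀ j, (w j).natDegree < L :=
  ⟨Finset.univ.sup (fun j => (w j).natDegree) + 1, fun j =>
    Nat.lt_succ_of_le (Finset.le_sup (f := fun j => (w j).natDegree) (Finset.mem_univ j))⟩

theorem exists_eq_sum_constWord (w : Fin n → K[X]) :
    ∃ L, w = ∑ m ∈ Finset.range L, (X ^ m : K[X]) • constWord (coeffWord w m) := by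
  obtain ⟨L, hL⟩ := exists_natDegree_lt w
  refine ⟨L, funext fun j => ?_⟩
  simp only [Finset.sum_apply, Pi.smul_apply, smul_eq_mul, constWord, coeffWord]
  conv_lhs => rw [as_sum_range' (w j) L (hL j)]
  exact Finset.sum_congr rfl fun m _ => by rw [← C_mul_X_pow_eq_monomial, mul_comm]

theorem mem_span_constWord {ι : Type*} [Fintype ι] {N : Submodule K (Fin n → K)}
    (b : Module.Basis ι K N) {w : Fin n → K[X]} (hw : ∀ m, coeffWord w m ∈ N) :
    w ∈ Submodule.span K[X] (Set.range fun i => constWord (b i : Fin n → K)) := by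
  obtain ⟨L, hL⟩ := exists_eq_sum_constWord w
  rw [hL]
  refine Submodule.sum_mem _ fun m _ => Submodule.smul_mem _ _ ?_
  have hsum := congrArg (Subtype.val) (b.sum_repr ⟨_, hw m⟩)
  have : constWord (coeffWord w m) =
      ∑ i, (C (b.repr ⟨_, hw m⟩ i) : K[X]) • constWord (b i : Fin n → K) := by
    funext j
    have := congrFun hsum j
    simp only [Submodule.coe_sum, Submodule.coe_smul, Finset.sum_apply, Pi.smul_apply,
      smul_eq_mul] at this
    simp only [Finset.sum_apply, Pi.smul_apply, smul_eq_mul, constWord, ← map_mul, ← map_sum, this]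
  rw [this]
  exact Submodule.sum_mem _ fun i _ => Submodule.smul_mem _ _ (Submodule.subset_span ⟨i, rfl⟩)

/-- The range is a submodule of a free module over a principal ideal domain, hence projective, so
the map onto it splits. -/
theorem exists_isCompl_ker {k : ℕ} (f : (Fin n → K[X]) →ₗ[K[X]] (Fin k → K[X])) :
    ∃ C' : Submodule K[X] (Fin n → K[X]), IsCompl (LinearMap.ker f) C' := by
  obtain ⟨g, hg⟩ := Module.projective_lifting_property f.rangeRestrict LinearMap.id
    f.surjective_rangeRestrict
  have hg' : ∀ y, f.rangeRestrict (g y) = y := fun y => LinearMap.congr_fun hg y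
  refine ⟨LinearMap.range g, ?_, ?_⟩
  · rw [Submodule.disjoint_def]
    rintro _ hx ⟨y, rfl⟩
    have : f.rangeRestrict (g y) = 0 := Subtype.ext hx
    rw [hg'] at this
    rw [this, map_zero]
  · rw [codisjoint_iff, eq_top_iff]
    intro x _
    refine Submodule.mem_sup.2 ⟨x - g (f.rangeRestrict x), ?_, g (f.rangeRestrict x), ⟨_, rfl⟩,
      sub_add_cancel _ _⟩
    have := congrArg Subtype.val (hg' (f.rangeRestrict x))
    rw [LinearMap.mem_ker, map_sub, sub_eq_zero]
    exact this.symm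

variable {κ μ : ℕ}

/-- A matrix filled up with zero rows at the bottom. -/
def padRows (κ : ℕ) (H₁ : Matrix (Fin μ) (Fin n) K) : Matrix (Fin κ) (Fin n) K :=
  fun i j => if h : (i : ℕ) < μ then H₁ ⟨i, h⟩ j else 0

theorem unitMemoryMatrix_apply (H₀ : Matrix (Fin κ) (Fin n) K) (H₁ : Matrix (Fin μ) (Fin n) K)
    (i : Fin κ) :
    unitMemoryMatrix H₀ H₁ i = fun j => C (H₀ i j) + X * C (padRows κ H₁ i j) := rfl

theorem padRows_castLE (hμ : μ ≤ κ) (H₁ : Matrix (Fin μ) (Fin n) K) (l : Fin μ) :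
    padRows κ H₁ (Fin.castLE hμ l) = H₁ l := by
  funext j
  simp [padRows]

theorem padRows_eq_zero {H₁ : Matrix (Fin μ) (Fin n) K} {i : Fin κ} (hi : ¬ (i : ℕ) < μ) :
    padRows κ H₁ i = 0 := by
  funext j
  simp [padRows, hi]

theorem padRows_cases (hμ : μ ≤ κ) (H₁ : Matrix (Fin μ) (Fin n) K) (i : Fin κ) :
    (∃ l, i = Fin.castLE hμ l ∧ padRows κ H₁ i = H₁ l) ∨
      (∀ l, i ≠ Fin.castLE hμ l) ∧ padRows κ H₁ i = 0 := by
  by_cases h : (i : ℕ) < μ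
  · exact Or.inl ⟨⟨i, h⟩, rfl, padRows_castLE hμ H₁ ⟨i, h⟩⟩
  · refine Or.inr ⟨fun l hl => h ?_, padRows_eq_zero h⟩
    rw [hl]
    exact l.2

theorem padRows_map {L : Type*} [Field L] (f : K →+* L) (H₁ : Matrix (Fin μ) (Fin n) K) :
    padRows κ (H₁.map f) = (padRows κ H₁).map f := by
  ext i j
  simp only [padRows, Matrix.map_apply]
  split_ifs <;> simp

/-- A sum over all rows, where the rows beyond the `μ`-th contribute nothing. -/
theorem sum_mul_padRows (hμ : μ ≤ κ) (a : Fin κ → K[X]) (H₁ : Matrix (Fin μ) (Fin n) K)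
    (j : Fin n) : ∑ i, a i * C (padRows κ H₁ i j) = ∑ l, a (Fin.castLE hμ l) * C (H₁ l j) := by
  symm
  refine Finset.sum_of_injOn (Fin.castLE hμ) (fun _ _ _ _ h => Fin.castLE_injective hμ h)
    (fun _ _ => Finset.mem_univ _) (fun i _ hi => ?_) (fun l _ => by rw [padRows_castLE])
  rw [padRows_eq_zero, Pi.zero_apply, C_0, mul_zero]
  exact fun h => hi ⟨⟨i, h⟩, Finset.mem_coe.2 (Finset.mem_univ _), rfl⟩

variable (H₀ : Matrix (Fin κ) (Fin n) K) (H₁ : Matrix (Fin μ) (Fin n) K)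

/-- The convolutional code dual to the code generated by `H₀ + D H̃₁`. -/
noncomputable def unitMemoryDual : Submodule K[X] (Fin n → K[X]) :=
  euclideanDual (rowModule (unitMemoryMatrix H₀ H₁))

/-- The matrix `D H₀ + H̃₁`. -/
noncomputable def reversedMatrix : Matrix (Fin κ) (Fin n) K[X] :=
  (X : K[X]) • H₀.map C + (padRows κ H₁).map C

variable {H₀ H₁}

theorem mem_unitMemoryDual {w : Fin n → K[X]} : w ∈ unitMemoryDual H₀ H₁ ↔
    ∀ i, X * constDot (H₀ i) w + constDot (padRows κ H₁ i) w = 0 := by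
  have : unitMemoryDual H₀ H₁ = convDual (RingHom.id K) (rowModule (unitMemoryMatrix H₀ H₁)) := rfl
  rw [this, mem_convDual_rowModule_iff]
  refine forall_congr' fun i => ?_
  rw [unitMemoryMatrix_apply, laurentInner_linear_right_eq_zero_iff]
  rfl

theorem unitMemoryDual_eq_ker :
    unitMemoryDual H₀ H₁ = LinearMap.ker (reversedMatrix H₀ H₁).mulVecLin := by
  ext w
  rw [mem_unitMemoryDual, LinearMap.mem_ker, funext_iff]
  refine forall_congr' fun i => ?_
  simp [reversedMatrix, Matrix.mulVec, dotProduct, constDot, Finset.mul_sum]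

theorem mem_unitMemoryDual' (hμ : μ ≤ κ) {w : Fin n → K[X]} : w ∈ unitMemoryDual H₀ H₁ ↔
    (∀ l, X * constDot (H₀ (Fin.castLE hμ l)) w + constDot (H₁ l) w = 0) ∧
      ∀ i : Fin κ, (∀ l, i ≠ Fin.castLE hμ l) → constDot (H₀ i) w = 0 := by
  rw [mem_unitMemoryDual]
  constructor
  · refine fun h => ⟨fun l => ?_, fun i hi => ?_⟩
    · have := h (Fin.castLE hμ l)
      rwa [padRows_castLE] at this
    · have := h i
      rcases padRows_cases hμ H₁ i with ⟨l, hl, -⟩ | ⟨-, h0⟩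
      · exact absurd hl (hi l)
      · rw [h0] at this
        simpa [constDot, X_ne_zero] using this
  · rintro ⟨h1, h2⟩ i
    rcases padRows_cases hμ H₁ i with ⟨l, rfl, h0⟩ | ⟨hi, h0⟩
    · rw [h0]; exact h1 l
    · rw [h0, h2 i hi]
      simp [constDot]

/-- For a constant word the two terms of the check D H₀ + H̃₁ occupy different powers of D and must
vanish separately. -/
theorem constWord_mem_unitMemoryDual (hμ : μ ≤ κ) {c : Fin n → K} :
    constWord c ∈ unitMemoryDual H₀ H₁ ↔ H₀.mulVec c = 0 ∧ H₁.mulVec c = 0 := by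
  rw [mem_unitMemoryDual' hμ]
  simp only [constDot_constWord]
  constructor
  · rintro ⟨h1, h2⟩
    have h3 : ∀ l, ∑ j, H₀ (Fin.castLE hμ l) j * c j = 0 ∧ ∑ j, H₁ l j * c j = 0 := by
      intro l
      have e0 := congrArg (fun p => coeff p 0) (h1 l)
      have e1 := congrArg (fun p => coeff p 1) (h1 l)
      simp only [coeff_add, coeff_X_mul_zero, coeff_C_zero, coeff_zero, zero_add] at e0
      simp only [coeff_add, coeff_X_mul, coeff_C_zero, coeff_zero, coeff_C_succ, add_zero] at e1
      exact ⟨e1, e0⟩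
    refine ⟨funext fun i => ?_, funext fun l => (h3 l).2⟩
    rcases padRows_cases hμ H₁ i with ⟨l, rfl, -⟩ | ⟨hi, -⟩
    · exact (h3 l).1
    · exact C_eq_zero.1 (h2 i hi)
  · rintro ⟨h1, h2⟩
    have h1' : ∀ i, ∑ j, H₀ i j * c j = 0 := fun i => congrFun h1 i
    have h2' : ∀ i, ∑ j, H₁ i j * c j = 0 := fun i => congrFun h2 i
    exact ⟨fun l => by rw [h1', h2']; simp, fun i _ => by rw [h1', C_0]⟩

/-! ### Rank, explicit generators and minimal row degrees of the dual code. -/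

/-- Right inverse of the stacked matrix, split into blocks. -/
structure IsBlockInverse (H₀ : Matrix (Fin κ) (Fin n) K) (H₁ : Matrix (Fin μ) (Fin n) K)
    (B₀ : Matrix (Fin n) (Fin κ) K) (B₁ : Matrix (Fin n) (Fin μ) K) : Prop where
  zero_zero : H₀ * B₀ = 1
  zero_one : H₀ * B₁ = 0
  one_zero : H₁ * B₀ = 0
  one_one : H₁ * B₁ = 1

theorem exists_isBlockInverse (h : LinearIndependent K fun i => Matrix.fromRows H₀ H₁ i) :
    ∃ B₀ B₁, IsBlockInverse H₀ H₁ B₀ B₁ := by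
  obtain ⟨B, hB⟩ := exists_right_inverse h
  rw [← Matrix.fromCols_toCols B, Matrix.fromRows_mul_fromCols, ← Matrix.fromBlocks_one,
    Matrix.fromBlocks_inj] at hB
  exact ⟨_, _, hB.1, hB.2.1, hB.2.2.1, hB.2.2.2⟩

theorem IsBlockInverse.map {L : Type*} [Field L] {B₀ : Matrix (Fin n) (Fin κ) K}
    {B₁ : Matrix (Fin n) (Fin μ) K} (hB : IsBlockInverse H₀ H₁ B₀ B₁) (f : K →+* L) :
    IsBlockInverse (H₀.map f) (H₁.map f) (B₀.map f) (B₁.map f) := by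
  constructor
  · rw [← Matrix.map_mul, hB.zero_zero, Matrix.map_one _ (map_zero f) (map_one f)]
  · rw [← Matrix.map_mul, hB.zero_one, Matrix.map_zero _ (map_zero f)]
  · rw [← Matrix.map_mul, hB.one_zero, Matrix.map_zero _ (map_zero f)]
  · rw [← Matrix.map_mul, hB.one_one, Matrix.map_one _ (map_zero f) (map_one f)]

variable {B₀ : Matrix (Fin n) (Fin κ) K} {B₁ : Matrix (Fin n) (Fin μ) K}

theorem IsBlockInverse.padRows_mul (hμ : μ ≤ κ) (hB : IsBlockInverse H₀ H₁ B₀ B₁) :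
    padRows κ H₁ * B₀ = 0 := by
  ext i k
  rw [Matrix.mul_apply]
  rcases padRows_cases hμ H₁ i with ⟨l, -, h⟩ | ⟨-, h⟩
  · rw [h]
    exact congrFun (congrFun hB.one_zero l) k
  · rw [h]
    simp

/-- The code is the kernel of D H₀ + H̃₁, and (D H₀ + H̃₁) B₀ = D · 1 shows that this matrix has
rank κ. -/
theorem finrank_unitMemoryDual (hμ : μ ≤ κ) (hB : IsBlockInverse H₀ H₁ B₀ B₁) :
    Module.finrank K[X] (unitMemoryDual H₀ H₁) + κ = n := by
  rw [unitMemoryDual_eq_ker]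
  set f := (reversedMatrix H₀ H₁).mulVecLin with hf
  have h1 := (LinearMap.ker f).finrank_quotient_add_finrank
  rw [Module.finrank_fin_fun, f.quotKerEquivRange.finrank_eq] at h1
  have h2 : Module.finrank K[X] (LinearMap.range f) ≤ κ := by
    simpa using Submodule.finrank_le (LinearMap.range f)
  have hM : reversedMatrix H₀ H₁ * B₀.map C = (X : K[X]) • 1 := by
    rw [reversedMatrix, Matrix.add_mul, Matrix.smul_mul, ← Matrix.map_mul, ← Matrix.map_mul,
      hB.zero_zero, hB.padRows_mul hμ, Matrix.map_one _ C_0 C_1, Matrix.map_zero _ C_0, add_zero]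
  have h3 : κ ≤ Module.finrank K[X] (LinearMap.range f) := by
    let g : (Fin κ → K[X]) →ₗ[K[X]] LinearMap.range f := f.rangeRestrict ∘ₗ (B₀.map C).mulVecLin
    have hg : Function.Injective g := by
      rw [injective_iff_map_eq_zero]
      intro a ha
      have h4 := congrArg Subtype.val ha
      change (reversedMatrix H₀ H₁).mulVec ((B₀.map C).mulVec a) = 0 at h4
      rw [Matrix.mulVec_mulVec, hM, Matrix.smul_mulVec, Matrix.one_mulVec] at h4
      exact (smul_eq_zero.1 h4).resolve_left X_ne_zero
    simpa using LinearMap.finrank_le_finrank_of_injective hg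
  omega

theorem isConvolutionalCode_unitMemoryDual (hμ : μ ≤ κ) (hB : IsBlockInverse H₀ H₁ B₀ B₁) :
    IsConvolutionalCode (unitMemoryDual H₀ H₁) (n - κ) := by
  refine ⟨inferInstance, ?_, ?_⟩
  · have := finrank_unitMemoryDual hμ hB
    omega
  · rw [unitMemoryDual_eq_ker]
    exact exists_isCompl_ker _

/-- The generators `b - D b'` of the dual code that are not constant. -/
noncomputable def linearGenerator (hμ : μ ≤ κ) (B₀ : Matrix (Fin n) (Fin κ) K)
    (B₁ : Matrix (Fin n) (Fin μ) K) (l : Fin μ) : Fin n → K[X] :=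
  fun j => C (B₀ j (Fin.castLE hμ l)) + X * C (-B₁ j l)

theorem linearGenerator_eq (hμ : μ ≤ κ) (B₀ : Matrix (Fin n) (Fin κ) K)
    (B₁ : Matrix (Fin n) (Fin μ) K) (l : Fin μ) : linearGenerator hμ B₀ B₁ l =
      fun j => C (B₀ j (Fin.castLE hμ l)) + X * C (-B₁ j l) := rfl

theorem IsBlockInverse.constDot_zero_linearGenerator (hμ : μ ≤ κ)
    (hB : IsBlockInverse H₀ H₁ B₀ B₁) (i : Fin κ) (l : Fin μ) :
    constDot (H₀ i) (linearGenerator hμ B₀ B₁ l) = if i = Fin.castLE hμ l then 1 else 0 := by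
  have h0 : ∑ j, H₀ i j * B₀ j (Fin.castLE hμ l) = _ :=
    congrFun (congrFun hB.zero_zero i) (Fin.castLE hμ l)
  have h1 : ∑ j, H₀ i j * B₁ j l = _ := congrFun (congrFun hB.zero_one i) l
  rw [linearGenerator_eq, constDot_linear, h0]
  simp only [mul_neg, Finset.sum_neg_distrib, h1, Matrix.one_apply]
  split_ifs <;> simp

theorem IsBlockInverse.constDot_one_linearGenerator (hμ : μ ≤ κ)
    (hB : IsBlockInverse H₀ H₁ B₀ B₁) (m l : Fin μ) :
    constDot (H₁ m) (linearGenerator hμ B₀ B₁ l) = if m = l then -X else 0 := by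
  have h0 : ∑ j, H₁ m j * B₀ j (Fin.castLE hμ l) = _ :=
    congrFun (congrFun hB.one_zero m) (Fin.castLE hμ l)
  have h1 : ∑ j, H₁ m j * B₁ j l = _ := congrFun (congrFun hB.one_one m) l
  rw [linearGenerator_eq, constDot_linear, h0]
  simp only [mul_neg, Finset.sum_neg_distrib, h1, Matrix.one_apply]
  split_ifs <;> simp

theorem IsBlockInverse.linearGenerator_mem (hμ : μ ≤ κ) (hB : IsBlockInverse H₀ H₁ B₀ B₁)
    (l : Fin μ) : linearGenerator hμ B₀ B₁ l ∈ unitMemoryDual H₀ H₁ := by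
  rw [mem_unitMemoryDual' hμ]
  refine ⟨fun m => ?_, fun i hi => ?_⟩
  · rw [hB.constDot_zero_linearGenerator, hB.constDot_one_linearGenerator]
    simp only [(Fin.castLE_injective hμ).eq_iff]
    split_ifs <;> simp
  · rw [hB.constDot_zero_linearGenerator, if_neg (hi l)]

/-- The block code with parity check matrix `H₀` stacked on `H₁`. -/
def stackedKer (H₀ : Matrix (Fin κ) (Fin n) K) (H₁ : Matrix (Fin μ) (Fin n) K) :
    Submodule K (Fin n → K) :=
  LinearMap.ker (Matrix.fromRows H₀ H₁).mulVecLin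

theorem mem_stackedKer {c : Fin n → K} :
    c ∈ stackedKer H₀ H₁ ↔ H₀.mulVec c = 0 ∧ H₁.mulVec c = 0 := by
  rw [stackedKer, LinearMap.mem_ker, Matrix.mulVecLin_apply, Matrix.fromRows_mulVec, funext_iff,
    funext_iff, funext_iff, Sum.forall]
  simp

theorem finrank_stackedKer (hB : IsBlockInverse H₀ H₁ B₀ B₁) :
    Module.finrank K (stackedKer H₀ H₁) + (κ + μ) = n := by
  have h := finrank_ker_mulVecLin (Matrix.fromRows H₀ H₁)
  have hr : (Matrix.fromRows H₀ H₁).rank = κ + μ := by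
    have hinv : Matrix.fromRows H₀ H₁ * Matrix.fromCols B₀ B₁ = 1 := by
      rw [Matrix.fromRows_mul_fromCols, hB.zero_zero, hB.zero_one, hB.one_zero, hB.one_one,
        Matrix.fromBlocks_one]
    have hs : LinearMap.range (Matrix.fromRows H₀ H₁).mulVecLin = ⊤ :=
      LinearMap.range_eq_top.2 (Matrix.mulVec_surjective_iff_exists_right_inverse.2 ⟨_, hinv⟩)
    rw [Matrix.rank, hs, finrank_top, Module.finrank_fintype_fun_eq_card]
    simp
  rw [hr] at h
  change _ + Module.finrank K (stackedKer H₀ H₁) = n at h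
  omega

theorem unitMemoryDual_le_span (hμ : μ ≤ κ) (hB : IsBlockInverse H₀ H₁ B₀ B₁) {ι : Type*}
    [Fintype ι] (b : Module.Basis ι K (stackedKer H₀ H₁)) :
    unitMemoryDual H₀ H₁ ≤ Submodule.span K[X] (Set.range
      (Sum.elim (fun i => constWord (b i : Fin n → K)) (linearGenerator hμ B₀ B₁))) := by
  intro w hw
  rw [mem_unitMemoryDual' hμ] at hw
  -- The linear generators are dual to the first μ rows of H₀, so subtracting `v` makes all
  -- H₀-checks vanish. The membership equations then make the H₁-checks vanish too, and every
  -- coefficient of the remainder lies in `stackedKer`.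
  set v : Fin n → K[X] := ∑ l, constDot (H₀ (Fin.castLE hμ l)) w • linearGenerator hμ B₀ B₁ l
    with hv
  rw [Set.Sum.elim_range, Submodule.span_union]
  refine Submodule.mem_sup.2 ⟨w - v, mem_span_constWord b fun m => ?_, v, ?_, sub_add_cancel w v⟩
  · have h0 : ∀ i, constDot (H₀ i) (w - v) = 0 := by
      intro i
      rw [constDot_sub, hv, constDot_sum]
      simp only [constDot_smul, hB.constDot_zero_linearGenerator]
      rcases padRows_cases hμ H₁ i with ⟨l, rfl, -⟩ | ⟨hi, -⟩
      · simp [(Fin.castLE_injective hμ).eq_iff]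
      · simp [hw.2 i hi, hi]
    have h1 : ∀ l, constDot (H₁ l) (w - v) = 0 := by
      intro l
      rw [constDot_sub, hv, constDot_sum]
      simp only [constDot_smul, hB.constDot_one_linearGenerator]
      have := hw.1 l
      simp only [mul_ite, mul_zero, Finset.sum_ite_eq, Finset.mem_univ, if_true]
      linear_combination this
    refine mem_stackedKer.2 ⟨funext fun i => ?_, funext fun l => ?_⟩
    · have := congrArg (fun p => coeff p m) (h0 i)
      simp only [coeff_constDot] at this
      exact this
    · have := congrArg (fun p => coeff p m) (h1 l)
      simp only [coeff_constDot] at this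
      exact this
  · exact Submodule.sum_mem _ fun l _ => Submodule.smul_mem _ _ (Submodule.subset_span ⟨l, rfl⟩)

theorem span_eq_unitMemoryDual (hμ : μ ≤ κ) (hB : IsBlockInverse H₀ H₁ B₀ B₁) {ι : Type*}
    [Fintype ι] (b : Module.Basis ι K (stackedKer H₀ H₁)) :
    Submodule.span K[X] (Set.range
      (Sum.elim (fun i => constWord (b i : Fin n → K)) (linearGenerator hμ B₀ B₁))) =
      unitMemoryDual H₀ H₁ := by
  refine le_antisymm (Submodule.span_le.2 ?_) (unitMemoryDual_le_span hμ hB b)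
  rintro _ ⟨i | l, rfl⟩
  · exact (constWord_mem_unitMemoryDual hμ).2 (mem_stackedKer.1 (b i).2)
  · exact hB.linearGenerator_mem hμ l

/-- Rows of degree zero come from `stackedKer`, of dimension n - κ - μ, whereas the code has rank n
- κ. At least μ rows must therefore have positive degree. -/
theorem le_sum_rowDegree (hμ : μ ≤ κ) (hB : IsBlockInverse H₀ H₁ B₀ B₁) {k : ℕ}
    {G : Matrix (Fin k) (Fin n) K[X]} (hG : rowModule G = unitMemoryDual H₀ H₁) :
    μ ≤ ∑ i, rowDegree G i := by
  classical
  let b := Module.finBasis K (stackedKer H₀ H₁)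
  have hrank := finrank_unitMemoryDual hμ hB
  have hker := finrank_stackedKer hB
  set t : Finset (Fin k) := Finset.univ.filter fun i => rowDegree G i ≠ 0 with ht
  set s : Finset (Fin n → K[X]) :=
    Finset.univ.image (fun i => constWord (b i : Fin n → K)) ∪ t.image fun i => G i with hs
  have hle : unitMemoryDual H₀ H₁ ≤ Submodule.span K[X] (s : Set (Fin n → K[X])) := by
    rw [← hG, rowModule, Submodule.span_le]
    rintro _ ⟨i, rfl⟩
    by_cases hi : rowDegree G i = 0
    · have hconst : G i = constWord (coeffWord (G i) 0) := by
        funext j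
        refine eq_C_of_natDegree_eq_zero (Nat.le_zero.1 ?_)
        rw [← hi]
        exact Finset.le_sup (f := fun j => (G i j).natDegree) (Finset.mem_univ j)
      have hmem : coeffWord (G i) 0 ∈ stackedKer H₀ H₁ := by
        rw [mem_stackedKer, ← constWord_mem_unitMemoryDual hμ, ← hconst, ← hG]
        exact Submodule.subset_span ⟨i, rfl⟩
      have h1 : constWord (coeffWord (G i) 0) ∈
          Submodule.span K[X] (Set.range fun i => constWord (b i : Fin n → K)) := by
        refine mem_span_constWord b fun m => ?_
        rcases m with _ | m
        · rwa [← hconst]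
        · have : coeffWord (constWord (coeffWord (G i) 0)) (m + 1) = 0 := by
            funext j
            simp [coeffWord, constWord]
          rw [this]
          exact zero_mem _
      rw [SetLike.mem_coe]
      change G i ∈ _
      rw [hconst]
      refine Submodule.span_mono ?_ h1
      rintro _ ⟨i, rfl⟩
      simp [hs]
    · refine Submodule.subset_span ?_
      simp only [hs, Finset.coe_union, Finset.coe_image]
      exact Or.inr ⟨i, by simpa [ht] using hi, rfl⟩
  have h1 : Module.finrank K[X] (unitMemoryDual H₀ H₁) ≤ s.card :=
    (Submodule.finrank_mono hle).trans (finrank_span_finset_le_card s)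
  have h2 : s.card ≤ Module.finrank K (stackedKer H₀ H₁) + t.card := by
    refine (Finset.card_union_le _ _).trans (add_le_add ?_ Finset.card_image_le)
    simpa using (Finset.card_image_le (s := Finset.univ)
      (f := fun i => constWord (b i : Fin n → K)))
  have h3 : t.card ≤ ∑ i, rowDegree G i := by
    rw [Finset.card_eq_sum_ones]
    refine (Finset.sum_le_sum fun i hi => ?_).trans
      (Finset.sum_le_sum_of_subset (Finset.subset_univ t))
    exact Nat.one_le_iff_ne_zero.2 (by simpa [ht] using hi)
  omega

theorem natDegree_linear_le (a b : K) : (C a + X * C b).natDegree ≤ 1 := by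
  refine (natDegree_add_le _ _).trans (max_le (by simp) ?_)
  exact (natDegree_mul_C_le _ _).trans natDegree_X_le

/-- The explicit generators have μ rows of degree one and all others constant, which attains the
lower bound `le_sum_rowDegree`; μ > 0 is what makes the memory 1 and not 0. -/
theorem isConvolutionalCodeWithMemory_unitMemoryDual (hμ : μ ≤ κ) (hμ0 : 0 < μ)
    (hB : IsBlockInverse H₀ H₁ B₀ B₁) :
    IsConvolutionalCodeWithMemory (unitMemoryDual H₀ H₁) (n - κ) 1 := by
  refine ⟨isConvolutionalCode_unitMemoryDual hμ hB, ?_⟩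
  let b := Module.finBasis K (stackedKer H₀ H₁)
  have hker := finrank_stackedKer hB
  let e : Fin (n - κ) ≃ Fin (Module.finrank K (stackedKer H₀ H₁)) ⊕ Fin μ :=
    (finCongr (by omega)).trans finSumFinEquiv.symm
  let g : Fin (Module.finrank K (stackedKer H₀ H₁)) ⊕ Fin μ → Fin n → K[X] :=
    Sum.elim (fun i => constWord (b i : Fin n → K)) (linearGenerator hμ B₀ B₁)
  let G : Matrix (Fin (n - κ)) (Fin n) K[X] := fun i => g (e i)
  have hG : rowModule G = unitMemoryDual H₀ H₁ := by
    rw [← span_eq_unitMemoryDual hμ hB b, rowModule]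
    congr 1
    exact e.surjective.range_comp g
  have hdeg0 : ∀ x, (Finset.univ.sup fun j => (g (Sum.inl x) j).natDegree) = 0 := by
    intro x
    simp [g, constWord]
  have hdeg1 : ∀ l, (Finset.univ.sup fun j => (g (Sum.inr l) j).natDegree) = 1 := by
    intro l
    refine le_antisymm (Finset.sup_le fun j _ => natDegree_linear_le _ _) ?_
    obtain ⟨j, hj⟩ : ∃ j, B₁ j l ≠ 0 := by
      by_contra! h
      have := congrFun (congrFun hB.one_one l) l
      simp [Matrix.mul_apply, h] at this
    refine le_trans ?_ (Finset.le_sup (Finset.mem_univ j))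
    refine le_natDegree_of_ne_zero ?_
    have hc : (g (Sum.inr l) j).coeff 1 = -B₁ j l := by
      simp only [g, Sum.elim_inr, linearGenerator, coeff_add, coeff_C_succ, coeff_X_mul,
        coeff_C_zero, zero_add]
    rw [hc]
    exact neg_ne_zero.2 hj
  have hsum : ∑ i, rowDegree G i = μ := by
    have : ∑ i, rowDegree G i = ∑ x, Finset.univ.sup fun j => (g x j).natDegree :=
      e.sum_comp fun x => Finset.univ.sup fun j => (g x j).natDegree
    rw [this, Fintype.sum_sum_type]
    simp [hdeg0, hdeg1]
  refine ⟨G, hG, fun G' hG' => hsum.trans_le (le_sum_rowDegree hμ hB hG'), ?_⟩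
  refine le_antisymm (Finset.sup_le fun i _ => ?_) ?_
  · change (Finset.univ.sup fun j => (g (e i) j).natDegree) ≤ 1
    rcases e i with x | l
    · rw [hdeg0]; exact Nat.zero_le _
    · rw [hdeg1]
  · refine le_trans ?_ (Finset.le_sup (Finset.mem_univ (e.symm (Sum.inr ⟨0, hμ0⟩))))
    change 1 ≤ Finset.univ.sup fun j => (g (e (e.symm (Sum.inr ⟨0, hμ0⟩))) j).natDegree
    rw [e.apply_symm_apply, hdeg1]

end UnitMemory


/-! ## The Hermitian dual -/

section Hermitian

variable {K : Type*} [Field K] {n κ μ : ℕ} {H₀ : Matrix (Fin κ) (Fin n) K}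
  {H₁ : Matrix (Fin μ) (Fin n) K} {B₀ : Matrix (Fin n) (Fin κ) K} {B₁ : Matrix (Fin n) (Fin μ) K}
  {σ : K →+* K}

theorem laurentInner_conj_row_eq_zero_iff (hσ : ∀ x, σ (σ x) = x) {w : Fin n → K[X]} (i : Fin κ) :
    laurentInner σ w (unitMemoryMatrix (H₀.map σ) (H₁.map σ) i) = 0 ↔
      X * constDot (H₀ i) w + constDot (padRows κ H₁ i) w = 0 := by
  rw [unitMemoryMatrix_apply, laurentInner_linear_right_eq_zero_iff, padRows_map]
  simp only [Matrix.map_apply, hσ]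

/-- The dual of the conjugated code is the Euclidean dual of the code. -/
theorem convDual_conj (hσ : ∀ x, σ (σ x) = x) :
    convDual σ (rowModule (unitMemoryMatrix (H₀.map σ) (H₁.map σ))) = unitMemoryDual H₀ H₁ := by
  ext w
  rw [mem_convDual_rowModule_iff, mem_unitMemoryDual]
  exact forall_congr' fun i => laurentInner_conj_row_eq_zero_iff hσ i

/-- The columns of 1 - B₀H₀ - B₁H₁ lie in `stackedKer`; writing out that u is orthogonal to the k-th
one expresses the k-th entry of u. -/
theorem eq_sum_of_constDot_eq_zero (hB : IsBlockInverse H₀ H₁ B₀ B₁) {u : Fin n → K[X]}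
    (hu : ∀ c ∈ stackedKer H₀ H₁, constDot (fun j => σ (c j)) u = 0) (k : Fin n) :
    u k = ∑ i, constDot (fun j => σ (B₀ j i)) u * C (σ (H₀ i k)) +
      ∑ l, constDot (fun j => σ (B₁ j l)) u * C (σ (H₁ l k)) := by
  have hmem : (fun j => (1 - B₀ * H₀ - B₁ * H₁ : Matrix (Fin n) (Fin n) K) j k) ∈
      stackedKer H₀ H₁ := by
    rw [mem_stackedKer]
    constructor
    · have : H₀ * (1 - B₀ * H₀ - B₁ * H₁) = 0 := by
        rw [Matrix.mul_sub, Matrix.mul_sub, ← Matrix.mul_assoc, ← Matrix.mul_assoc, hB.zero_zero,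
          hB.zero_one]
        simp
      exact funext fun i => congrFun (congrFun this i) k
    · have : H₁ * (1 - B₀ * H₀ - B₁ * H₁) = 0 := by
        rw [Matrix.mul_sub, Matrix.mul_sub, ← Matrix.mul_assoc, ← Matrix.mul_assoc, hB.one_zero,
          hB.one_one]
        simp
      exact funext fun i => congrFun (congrFun this i) k
  have h := hu _ hmem
  have e : constDot (fun j => σ ((1 - B₀ * H₀ - B₁ * H₁ : Matrix (Fin n) (Fin n) K) j k)) u =
      u k - ∑ i, constDot (fun j => σ (B₀ j i)) u * C (σ (H₀ i k)) -
      ∑ l, constDot (fun j => σ (B₁ j l)) u * C (σ (H₁ l k)) := by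
    simp only [constDot, Matrix.sub_apply, Matrix.mul_apply, Matrix.one_apply, map_sub, map_sum,
      map_mul, sub_mul, Finset.sum_sub_distrib, Finset.sum_mul]
    congr 1
    · congr 1
      · simp [apply_ite σ, apply_ite C]
      · rw [Finset.sum_comm]
        exact Finset.sum_congr rfl fun i _ => Finset.sum_congr rfl fun j _ => by ring
    · rw [Finset.sum_comm]
      exact Finset.sum_congr rfl fun i _ => Finset.sum_congr rfl fun j _ => by ring
  rw [e] at h
  linear_combination h

/-- A double-dual statement, proved by testing against the generators. Orthogonality to the constant
words expands u in the conjugated rows of H₀ and H₁; orthogonality to the linear generators makes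
the coefficient at row l of H₁ equal to D times the one at row l of H₀, so the rows combine into
those of H₀ + D H̃₁. -/
theorem convDual_unitMemoryDual (hμ : μ ≤ κ) (hB : IsBlockInverse H₀ H₁ B₀ B₁)
    (hσ : ∀ x, σ (σ x) = x) : convDual σ (unitMemoryDual H₀ H₁) =
      rowModule (unitMemoryMatrix (H₀.map σ) (H₁.map σ)) := by
  refine le_antisymm (fun u hu => ?_) (Submodule.span_le.2 ?_)
  · rw [mem_convDual_iff] at hu
    have hu0 : ∀ c ∈ stackedKer H₀ H₁, constDot (fun j => σ (c j)) u = 0 := by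
      intro c hc
      have h := hu _ ((constWord_mem_unitMemoryDual hμ).2 (mem_stackedKer.1 hc))
      have e : constWord c = fun j => C (c j) + X * C ((0 : Fin n → K) j) := by
        funext j
        simp [constWord]
      rw [e, laurentInner_linear_right_eq_zero_iff] at h
      simpa [constDot, X_ne_zero] using h
    have hu1 : ∀ l, constDot (fun j => σ (B₁ j l)) u =
        X * constDot (fun j => σ (B₀ j (Fin.castLE hμ l))) u := by
      intro l
      have h := hu _ (hB.linearGenerator_mem hμ l)
      rw [linearGenerator_eq, laurentInner_linear_right_eq_zero_iff] at h
      have e : constDot (fun j => σ (-B₁ j l)) u = -constDot (fun j => σ (B₁ j l)) u := by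
        simp [constDot]
      rw [e] at h
      linear_combination -h
    have e : u = ∑ i, constDot (fun j => σ (B₀ j i)) u •
        unitMemoryMatrix (H₀.map σ) (H₁.map σ) i := by
      funext k
      simp only [Finset.sum_apply, Pi.smul_apply, smul_eq_mul, unitMemoryMatrix_apply, mul_add,
        Finset.sum_add_distrib, ← mul_assoc]
      rw [sum_mul_padRows hμ (fun i => constDot (fun j => σ (B₀ j i)) u * X)]
      conv_lhs => rw [eq_sum_of_constDot_eq_zero hB hu0 k]
      simp only [hu1, Matrix.map_apply, mul_comm X]
    rw [e]
    exact Submodule.sum_mem _ fun i _ => Submodule.smul_mem _ _ (Submodule.subset_span ⟨i, rfl⟩)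
  · rintro _ ⟨i, rfl⟩
    rw [SetLike.mem_coe, mem_convDual_iff]
    intro w hw
    rw [← laurentInner_swap σ hσ,
      (laurentInner_conj_row_eq_zero_iff hσ i).2 (mem_unitMemoryDual.1 hw i), map_zero, map_zero]

theorem rowModule_conj_le (hμ : μ ≤ κ)
    (horth : ∀ x y, ∑ j, Matrix.fromRows H₀ H₁ x j * σ (Matrix.fromRows H₀ H₁ y j) = 0) :
    rowModule (unitMemoryMatrix (H₀.map σ) (H₁.map σ)) ≤ unitMemoryDual H₀ H₁ := by
  have hrow : ∀ x i, constDot (Matrix.fromRows H₀ H₁ x)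
      (unitMemoryMatrix (H₀.map σ) (H₁.map σ) i) = 0 := by
    intro x i
    rw [unitMemoryMatrix_apply, constDot_linear, padRows_map]
    have h0 := horth x (Sum.inl i)
    simp only [Matrix.fromRows_apply_inl] at h0
    simp only [Matrix.map_apply, h0]
    rcases padRows_cases hμ H₁ i with ⟨l, -, h⟩ | ⟨-, h⟩
    · have h1 := horth x (Sum.inr l)
      simp only [Matrix.fromRows_apply_inr] at h1
      simp [h, h1]
    · simp [h]
  refine Submodule.span_le.2 ?_
  rintro _ ⟨i, rfl⟩
  rw [SetLike.mem_coe, mem_unitMemoryDual' hμ]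
  have h0 : ∀ k, constDot (H₀ k) (unitMemoryMatrix (H₀.map σ) (H₁.map σ) i) = 0 :=
    fun k => hrow (Sum.inl k) i
  have h1 : ∀ k, constDot (H₁ k) (unitMemoryMatrix (H₀.map σ) (H₁.map σ) i) = 0 :=
    fun k => hrow (Sum.inr k) i
  exact ⟨fun l => by rw [h0, h1, mul_zero, add_zero], fun k _ => h0 k⟩

end Hermitian

/-! ## Weights of words of the dual code -/

section Weight

variable {K : Type*} [Field K] [DecidableEq K] {n κ μ : ℕ} {H₀ : Matrix (Fin κ) (Fin n) K}
  {H₁ : Matrix (Fin μ) (Fin n) K}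

theorem hammingNorm_coeffWord (w : Fin n → K[X]) (m : ℕ) :
    hammingNorm (coeffWord w m) = ∑ j, if m ∈ (w j).support then 1 else 0 := by
  rw [hammingNorm, Finset.card_filter]
  exact Finset.sum_congr rfl fun j _ => if_congr mem_support_iff.symm rfl rfl

theorem hammingNorm_le_sum_card_support (w : Fin n → K[X]) (m : ℕ) :
    hammingNorm (coeffWord w m) ≤ ∑ j, (w j).support.card := by
  rw [hammingNorm_coeffWord]
  refine Finset.sum_le_sum fun j _ => ?_
  split_ifs with h
  · exact Finset.card_pos.2 ⟨m, h⟩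
  · exact Nat.zero_le _

theorem hammingNorm_add_le_sum_card_support (w : Fin n → K[X]) {s t : ℕ} (hst : s ≠ t) :
    hammingNorm (coeffWord w s) + hammingNorm (coeffWord w t) ≤ ∑ j, (w j).support.card := by
  rw [hammingNorm_coeffWord, hammingNorm_coeffWord, ← Finset.sum_add_distrib]
  refine Finset.sum_le_sum fun j _ => ?_
  have h : (({s, t} : Finset ℕ).filter fun m => m ∈ (w j).support).card ≤ (w j).support.card :=
    Finset.card_le_card fun m hm => (Finset.mem_filter.1 hm).2
  rwa [Finset.card_filter, Finset.sum_pair hst] at h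

/-- A nonzero word of the dual code has a first coefficient in the block code checked by `H₁` and a
last one in the block code checked by `H₀`. -/
theorem exists_first_last (hμ : μ ≤ κ) {w : Fin n → K[X]} (hw : w ∈ unitMemoryDual H₀ H₁)
    (hw0 : w ≠ 0) : ∃ s t, coeffWord w s ≠ 0 ∧ coeffWord w t ≠ 0 ∧
      H₁.mulVec (coeffWord w s) = 0 ∧ H₀.mulVec (coeffWord w t) = 0 := by
  obtain ⟨L, hL⟩ := exists_natDegree_lt w
  set S := (Finset.range L).filter fun m => coeffWord w m ≠ 0 with hS
  have hmem : ∀ m, coeffWord w m ≠ 0 → m ∈ S := by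
    intro m hm
    refine Finset.mem_filter.2 ⟨Finset.mem_range.2 ?_, hm⟩
    by_contra! h
    exact hm (funext fun j => coeff_eq_zero_of_natDegree_lt ((hL j).trans_le h))
  have hne : S.Nonempty := by
    by_contra h
    rw [Finset.not_nonempty_iff_eq_empty] at h
    refine hw0 (funext fun j => Polynomial.ext fun m => ?_)
    by_contra hj
    have : m ∈ S := hmem m fun h0 => hj (congrFun h0 j)
    simp [h] at this
  rw [mem_unitMemoryDual' hμ] at hw
  have hs0 := (Finset.mem_filter.1 (S.min'_mem hne)).2
  have ht0 := (Finset.mem_filter.1 (S.max'_mem hne)).2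
  refine ⟨S.min' hne, S.max' hne, hs0, ht0, funext fun l => ?_, funext fun i => ?_⟩
  · set s := S.min' hne with hs
    have h := congrArg (fun p => coeff p s) (hw.1 l)
    -- In D H₀ + H̃₁ the H₀-part at D^s sees only the coefficient s - 1, which vanishes by
    -- minimality of `s`.
    have h0 : (X * constDot (H₀ (Fin.castLE hμ l)) w).coeff s = 0 := by
      rcases hs' : s with _ | m
      · simp
      · rw [coeff_X_mul, coeff_constDot]
        have hm : coeffWord w m = 0 := by
          by_contra h
          have := S.min'_le m (hmem m h)
          omega
        exact Finset.sum_eq_zero fun j _ => by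
          rw [show (w j).coeff m = 0 from congrFun hm j, mul_zero]
    simp only [coeff_add, h0, zero_add, coeff_constDot, coeff_zero] at h
    exact h
  · set t := S.max' hne with ht
    -- At D^(t+1) the H₁-part vanishes by maximality of `t`, leaving the H₀-checks of the
    -- coefficient at t.
    have ht1 : coeffWord w (t + 1) = 0 := by
      by_contra h
      have := S.le_max' (t + 1) (hmem _ h)
      omega
    have key : (constDot (H₀ i) w).coeff t = 0 := by
      rcases padRows_cases hμ H₁ i with ⟨l, rfl, -⟩ | ⟨hi, -⟩
      · have h := congrArg (fun p => coeff p (t + 1)) (hw.1 l)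
        simp only [coeff_add, coeff_X_mul, coeff_zero] at h
        rw [coeff_constDot (H₁ l), Finset.sum_eq_zero, add_zero] at h
        · exact h
        · exact fun j _ => by
            rw [show (w j).coeff (t + 1) = 0 from congrFun ht1 j, mul_zero]
      · rw [hw.2 i hi, coeff_zero]
    rw [coeff_constDot] at key
    exact key

end Weight


/-! ## From Hermitian to symplectic orthogonality -/

section Quantum

variable {F K : Type*} [Field F] [Field K] [Algebra F K] {n : ℕ} (β : Module.Basis (Fin 2) F K)

/-- The identification `(x | z) ↦ β₀ x + β₁ z`. -/
noncomputable def pairWord (s : (Fin n → F[X]) × (Fin n → F[X])) : Fin n → K[X] := fun j =>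
  C (β 0) * (s.1 j).map (algebraMap F K) + C (β 1) * (s.2 j).map (algebraMap F K)

theorem pairWord_add (s t : (Fin n → F[X]) × (Fin n → F[X])) :
    pairWord β (s + t) = pairWord β s + pairWord β t := by
  funext j
  simp only [pairWord, Prod.fst_add, Prod.snd_add, Pi.add_apply, Polynomial.map_add]
  ring

theorem pairWord_smul (p : F[X]) (s : (Fin n → F[X]) × (Fin n → F[X])) :
    pairWord β (p • s) = p.map (algebraMap F K) • pairWord β s := by
  funext j
  simp only [pairWord, Prod.smul_fst, Prod.smul_snd, Pi.smul_apply, smul_eq_mul,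
    Polynomial.map_mul]
  ring

theorem pairWord_sum {ι : Type*} (S : Finset ι) (s : ι → (Fin n → F[X]) × (Fin n → F[X])) :
    pairWord β (∑ i ∈ S, s i) = ∑ i ∈ S, pairWord β (s i) :=
  map_sum (AddMonoidHom.mk' (pairWord β) (pairWord_add β)) s S

theorem pairWord_zero : pairWord β (0 : (Fin n → F[X]) × (Fin n → F[X])) = 0 := by
  funext j
  simp [pairWord]

theorem repr_add_eq (y : K) :
    β 0 * algebraMap F K (β.repr y 0) + β 1 * algebraMap F K (β.repr y 1) = y := by
  have := β.sum_repr y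
  rw [Fin.sum_univ_two] at this
  simpa [Algebra.smul_def, mul_comm] using this

theorem eq_zero_of_add_eq_zero {a b : F}
    (h : β 0 * algebraMap F K a + β 1 * algebraMap F K b = 0) : a = 0 ∧ b = 0 := by
  have hli := Fintype.linearIndependent_iff.1 β.linearIndependent ![a, b]
    (by simpa [Fin.sum_univ_two, Algebra.smul_def, mul_comm] using h)
  exact ⟨hli 0, hli 1⟩

theorem coeff_pairWord (s : (Fin n → F[X]) × (Fin n → F[X])) (j : Fin n) (m : ℕ) :
    (pairWord β s j).coeff m = β 0 * algebraMap F K ((s.1 j).coeff m) +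
      β 1 * algebraMap F K ((s.2 j).coeff m) := by
  simp [pairWord, coeff_C_mul]

theorem support_pairWord (s : (Fin n → F[X]) × (Fin n → F[X])) (j : Fin n) :
    (pairWord β s j).support = (s.1 j).support ∪ (s.2 j).support := by
  ext m
  rw [Finset.mem_union, mem_support_iff, mem_support_iff, mem_support_iff, coeff_pairWord,
    ← not_and_or, not_iff_not]
  refine ⟨eq_zero_of_add_eq_zero β, ?_⟩
  rintro ⟨h1, h2⟩
  simp [h1, h2]

theorem symplecticWeight_eq (s : (Fin n → F[X]) × (Fin n → F[X])) :
    symplecticWeight s = ∑ j, (pairWord β s j).support.card := by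
  simp only [support_pairWord, symplecticWeight]

theorem pairWord_injective : Function.Injective (pairWord β (n := n)) := by
  intro s t h
  have key : ∀ j m, (s.1 j).coeff m = (t.1 j).coeff m ∧ (s.2 j).coeff m = (t.2 j).coeff m := by
    intro j m
    have h1 := congrArg (fun u => (u j).coeff m) h
    simp only [coeff_pairWord] at h1
    rw [← sub_eq_zero, ← sub_eq_zero (a := (s.2 j).coeff m)]
    refine eq_zero_of_add_eq_zero β ?_
    rw [map_sub, map_sub]
    linear_combination h1
  exact Prod.ext (funext fun j => Polynomial.ext fun m => (key j m).1)
    (funext fun j => Polynomial.ext fun m => (key j m).2)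

theorem exists_eq_polynomial_pair (p : K[X]) : ∃ x z : F[X],
    p = C (β 0) * x.map (algebraMap F K) + C (β 1) * z.map (algebraMap F K) := by
  induction p using Polynomial.induction_on' with
  | add p q hp hq =>
    obtain ⟨x, z, rfl⟩ := hp
    obtain ⟨x', z', rfl⟩ := hq
    refine ⟨x + x', z + z', ?_⟩
    rw [Polynomial.map_add, Polynomial.map_add]
    ring
  | monomial k a =>
    refine ⟨monomial k (β.repr a 0), monomial k (β.repr a 1), ?_⟩
    rw [map_monomial, map_monomial, C_mul_monomial, C_mul_monomial, ← map_add, repr_add_eq]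

theorem pairWord_surjective : Function.Surjective (pairWord β (n := n)) := by
  intro u
  choose x z h using fun j => exists_eq_polynomial_pair β (u j)
  exact ⟨(x, z), funext fun j => (h j).symm⟩

/-- The q-Frobenius has order [K : F]; were it trivial, K would have only q elements. -/
theorem exists_ne_of_pow {q : ℕ} [Fintype F] [Fintype K] (hF : Fintype.card F = q)
    (hK : Fintype.card K = q ^ 2) : ∃ γ : K, γ ^ q ≠ γ := by
  by_contra! h
  have h1 := FiniteField.orderOf_frobeniusAlgHom F K
  have h2 : FiniteField.frobeniusAlgHom F K = 1 := AlgHom.ext fun x => by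
    rw [FiniteField.coe_frobeniusAlgHom, hF]
    exact h x
  rw [h2, orderOf_one] at h1
  have h3 := Module.card_eq_pow_finrank (K := F) (V := K)
  rw [← h1, hF, hK, pow_one] at h3
  have : 1 < q := hF ▸ Fintype.one_lt_card
  nlinarith

variable {σ : K →+* K}

/-- The bridge between the two forms: the terms with β₀σ(β₀) and β₁σ(β₁) are fixed by σ and cancel,
and the mixed terms leave a determinant times the symplectic form. -/
theorem laurentInner_sub_conj (hσF : ∀ x : F, σ (algebraMap F K x) = algebraMap F K x)
    (hσ : ∀ x, σ (σ x) = x) (s t : (Fin n → F[X]) × (Fin n → F[X])) :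
    laurentInner σ (pairWord β s) (pairWord β t) -
        laurentMap σ (laurentInner σ (pairWord β s) (pairWord β t)) =
      LaurentPolynomial.C (β 0 * σ (β 1) - σ (β 0) * β 1) *
        laurentMap (algebraMap F K) (symplecticForm s t) := by
  have hc : σ.comp (algebraMap F K) = algebraMap F K := RingHom.ext hσF
  simp only [laurentInner, symplecticForm, pairWord, map_sum, map_sub, map_mul, map_add,
    laurentMap_invert, laurentMap_toLaurent, laurentMap_C, Polynomial.map_add, Polynomial.map_mul,
    Polynomial.map_map, hc, Polynomial.map_C, hσ, toLaurent_C, LaurentPolynomial.invert_C,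
    Finset.mul_sum, ← Finset.sum_sub_distrib]
  refine Finset.sum_congr rfl fun j _ => ?_
  ring

/-- If the determinant vanished, then β₀σ(γ) = γσ(β₀) for γ = β₀, β₁ and so for every γ by
linearity; γ = 1 gives σ(β₀) = β₀, whence σ would be the identity. -/
theorem symplectic_det_ne_zero (hσF : ∀ x : F, σ (algebraMap F K x) = algebraMap F K x)
    (hne : ∃ γ, σ γ ≠ γ) : β 0 * σ (β 1) - σ (β 0) * β 1 ≠ 0 := by
  intro h
  have h1 : ∀ γ : K, β 0 * σ γ = γ * σ (β 0) := by
    intro γ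
    rw [← repr_add_eq β γ]
    simp only [map_add, map_mul, hσF]
    linear_combination algebraMap F K (β.repr γ 1) * h
  have h2 : β 0 = σ (β 0) := by simpa using h1 1
  obtain ⟨γ, hγ⟩ := hne
  refine hγ (mul_left_cancel₀ (β.ne_zero 0) ?_)
  rw [h1 γ, ← h2, mul_comm]

theorem symplecticForm_eq_zero (hσF : ∀ x : F, σ (algebraMap F K x) = algebraMap F K x)
    (hσ : ∀ x, σ (σ x) = x) (hne : ∃ γ, σ γ ≠ γ) {s t : (Fin n → F[X]) × (Fin n → F[X])}
    (h : laurentInner σ (pairWord β s) (pairWord β t) = 0) : symplecticForm s t = 0 := by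
  have h1 := laurentInner_sub_conj β hσF hσ s t
  rw [h, map_zero, sub_zero, eq_comm] at h1
  have h2 : laurentMap (algebraMap F K) (symplecticForm s t) = 0 := by
    refine LaurentPolynomial.ext fun m => ?_
    have := congrArg (fun f => f.coeff m) h1
    simp only [coeff_C_mul'] at this
    exact (mul_eq_zero.1 this).resolve_left (symplectic_det_ne_zero β hσF hne)
  exact laurentMap_injective (algebraMap F K).injective (h2.trans (map_zero _).symm)

/-- Words that are symplectically orthogonal to a `K[D]`-module are Hermitian orthogonal to it. -/
theorem pairWord_mem_convDual (hσF : ∀ x : F, σ (algebraMap F K x) = algebraMap F K x)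
    (hσ : ∀ x, σ (σ x) = x) (hne : ∃ γ, σ γ ≠ γ) {V : Submodule K[X] (Fin n → K[X])}
    {s : (Fin n → F[X]) × (Fin n → F[X])}
    (h : ∀ t, pairWord β t ∈ V → symplecticForm s t = 0) : pairWord β s ∈ convDual σ V := by
  rw [mem_convDual_iff]
  have h1 : ∀ v ∈ V, laurentInner σ (pairWord β s) v =
      laurentMap σ (laurentInner σ (pairWord β s) v) := by
    intro v hv
    obtain ⟨t, rfl⟩ := pairWord_surjective β v
    have := laurentInner_sub_conj β hσF hσ s t
    rwa [h t hv, map_zero (laurentMap _), mul_zero, sub_eq_zero] at this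
  intro v hv
  obtain ⟨γ, hγ⟩ := hne
  refine LaurentPolynomial.ext fun m => ?_
  have e1 := congrArg (fun f => f.coeff m) (h1 v hv)
  -- Symplectic orthogonality only says that the product is fixed by σ. Since V is closed under
  -- multiplication by γ, its multiple by σ(γ) is fixed too, and σ(γ) ≠ γ forces it to vanish.
  have e2 := congrArg (fun f => f.coeff m) (h1 _ (V.smul_mem (C γ) hv))
  simp only [laurentInner_smul_right, Polynomial.map_C, toLaurent_C, LaurentPolynomial.invert_C,
    laurentMap_C, coeff_laurentMap, coeff_C_mul', map_mul, hσ] at e1 e2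
  rw [← e1, ← sub_eq_zero, ← sub_mul] at e2
  exact (mul_eq_zero.1 e2).resolve_left (sub_ne_zero.2 hγ)

/-! ### The stabilizer matrix -/

variable {k κ μ : ℕ} (A₀ : Matrix (Fin κ) (Fin n) K) (A₁ : Matrix (Fin μ) (Fin n) K)

/-- The word over `F` whose image under `pairWord` is `β_a` times the `i`-th row of
`A₀ + D Ã₁`. -/
noncomputable def stabilizerRow (x : Fin κ × Fin 2) : (Fin n → F[X]) × (Fin n → F[X]) :=
  (fun j => C (β.repr (β x.2 * A₀ x.1 j) 0) + X * C (β.repr (β x.2 * padRows κ A₁ x.1 j) 0),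
   fun j => C (β.repr (β x.2 * A₀ x.1 j) 1) + X * C (β.repr (β x.2 * padRows κ A₁ x.1 j) 1))

theorem pairWord_stabilizerRow (x : Fin κ × Fin 2) :
    pairWord β (stabilizerRow β A₀ A₁ x) =
      (C (β x.2) : K[X]) • unitMemoryMatrix A₀ A₁ x.1 := by
  funext j
  have h0 := congrArg (C : K → K[X]) (repr_add_eq β (β x.2 * A₀ x.1 j))
  have h1 := congrArg (C : K → K[X]) (repr_add_eq β (β x.2 * padRows κ A₁ x.1 j))
  simp only [map_add, map_mul] at h0 h1
  rw [Pi.smul_apply, smul_eq_mul, unitMemoryMatrix_apply]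
  simp only [pairWord, stabilizerRow, Polynomial.map_add, Polynomial.map_mul, Polynomial.map_C,
    map_X]
  linear_combination h0 + X * h1

/-- Taking both β₀ and β₁ times each row makes the F[D]-span closed under K[D]: every coefficient in
K[D] is β₀x + β₁z with x, z in F[D]. -/
theorem span_stabilizerRow_iff (s : (Fin n → F[X]) × (Fin n → F[X])) :
    s ∈ Submodule.span F[X] (Set.range (stabilizerRow β A₀ A₁)) ↔
      pairWord β s ∈ rowModule (unitMemoryMatrix A₀ A₁) := by
  constructor
  · intro hs
    induction hs using Submodule.span_induction with
    | mem s hs =>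
      obtain ⟨x, rfl⟩ := hs
      rw [pairWord_stabilizerRow]
      exact Submodule.smul_mem _ _ (Submodule.subset_span ⟨x.1, rfl⟩)
    | zero =>
      rw [pairWord_zero]
      exact zero_mem _
    | add s t _ _ hs ht =>
      rw [pairWord_add]
      exact add_mem hs ht
    | smul p s _ hs =>
      rw [pairWord_smul]
      exact Submodule.smul_mem _ _ hs
  · intro hs
    obtain ⟨a, ha⟩ := (Submodule.mem_span_range_iff_exists_fun K[X]).1 hs
    choose x z h using fun i => exists_eq_polynomial_pair β (a i)
    have e : s = ∑ i, (x i • stabilizerRow β A₀ A₁ (i, 0) + z i • stabilizerRow β A₀ A₁ (i, 1)) := by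
      refine pairWord_injective β ?_
      rw [pairWord_sum, ← ha]
      refine Finset.sum_congr rfl fun i _ => ?_
      rw [pairWord_add, pairWord_smul, pairWord_smul, pairWord_stabilizerRow,
        pairWord_stabilizerRow, smul_smul, smul_smul, ← add_smul]
      conv_lhs => rw [h]
      congr 1
      ring
    rw [e]
    exact Submodule.sum_mem _ fun i _ => add_mem
      (Submodule.smul_mem _ _ (Submodule.subset_span ⟨_, rfl⟩))
      (Submodule.smul_mem _ _ (Submodule.subset_span ⟨_, rfl⟩))

theorem sum_repr_mul_repr (y b : K) (a : Fin 2) :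
    β.repr y 0 * β.repr (β 0 * b) a + β.repr y 1 * β.repr (β 1 * b) a = β.repr (y * b) a := by
  have : y * b = β.repr y 0 • (β 0 * b) + β.repr y 1 • (β 1 * b) := by
    conv_lhs => rw [← repr_add_eq β y]
    simp only [Algebra.smul_def]
    ring
  rw [this, map_add, map_smul, map_smul]
  rfl

/-- The right inverse of the stabilizer matrix. -/
noncomputable def stabilizerInverse (B₀ : Matrix (Fin n) (Fin κ) K) :
    Matrix (Fin n ⊕ Fin n) (Fin κ × Fin 2) F[X] :=
  Matrix.fromRows (fun j y => C (β.repr (β 0 * B₀ j y.1) y.2))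
    (fun j y => C (β.repr (β 1 * B₀ j y.1) y.2))

theorem stabilizerInverse_inl (B₀ : Matrix (Fin n) (Fin κ) K) (j : Fin n) (y : Fin κ × Fin 2) :
    stabilizerInverse β B₀ (Sum.inl j) y = C (β.repr (β 0 * B₀ j y.1) y.2) := rfl

theorem stabilizerInverse_inr (B₀ : Matrix (Fin n) (Fin κ) K) (j : Fin n) (y : Fin κ × Fin 2) :
    stabilizerInverse β B₀ (Sum.inr j) y = C (β.repr (β 1 * B₀ j y.1) y.2) := rfl

variable {A₀ A₁}

/-- The constant matrix B₀, with entries read as F-linear multiplications, already inverts the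
stabilizer matrix: A₀B₀ = 1, and Ã₁B₀ = 0 removes the D-term. -/
theorem stabilizerRow_mul_inverse (hμ : μ ≤ κ) {B₀ : Matrix (Fin n) (Fin κ) K}
    {B₁ : Matrix (Fin n) (Fin μ) K} (hB : IsBlockInverse A₀ A₁ B₀ B₁) (x y : Fin κ × Fin 2) :
    ∑ j, (stabilizerRow β A₀ A₁ x).1 j * stabilizerInverse β B₀ (Sum.inl j) y +
      ∑ j, (stabilizerRow β A₀ A₁ x).2 j * stabilizerInverse β B₀ (Sum.inr j) y =
      if x = y then 1 else 0 := by
  have h0 : ∑ j, β x.2 * A₀ x.1 j * B₀ j y.1 = if x.1 = y.1 then β x.2 else 0 := by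
    have := congrFun (congrFun hB.zero_zero x.1) y.1
    rw [Matrix.mul_apply, Matrix.one_apply] at this
    simp only [mul_assoc, ← Finset.mul_sum, this]
    split_ifs <;> simp
  have h1 : ∑ j, β x.2 * padRows κ A₁ x.1 j * B₀ j y.1 = 0 := by
    have := congrFun (congrFun (hB.padRows_mul hμ) x.1) y.1
    rw [Matrix.mul_apply] at this
    simp only [mul_assoc, ← Finset.mul_sum, this]
    simp
  have e : ∀ j, (stabilizerRow β A₀ A₁ x).1 j * stabilizerInverse β B₀ (Sum.inl j) y +
      (stabilizerRow β A₀ A₁ x).2 j * stabilizerInverse β B₀ (Sum.inr j) y =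
      C (β.repr (β x.2 * A₀ x.1 j * B₀ j y.1) y.2) +
        X * C (β.repr (β x.2 * padRows κ A₁ x.1 j * B₀ j y.1) y.2) := by
    intro j
    rw [← sum_repr_mul_repr β (β x.2 * A₀ x.1 j), ← sum_repr_mul_repr β (β x.2 * _)]
    simp only [stabilizerRow, stabilizerInverse_inl, stabilizerInverse_inr, map_add, map_mul]
    ring
  rw [← Finset.sum_add_distrib, Finset.sum_congr rfl fun j _ => e j, Finset.sum_add_distrib,
    ← Finset.mul_sum, ← map_sum, ← map_sum]
  have h0' : ∑ j, β.repr (β x.2 * A₀ x.1 j * B₀ j y.1) y.2 = if x = y then 1 else 0 := by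
    rw [← Finsupp.finsetSum_apply, ← map_sum, h0]
    rcases x with ⟨i, a⟩
    rcases y with ⟨i', a'⟩
    by_cases hi : i = i' <;> simp [hi, Finsupp.single_apply]
  have h1' : ∑ j, β.repr (β x.2 * padRows κ A₁ x.1 j * B₀ j y.1) y.2 = 0 := by
    rw [← Finsupp.finsetSum_apply, ← map_sum, h1]
    simp
  rw [h0', h1']
  split_ifs <;> simp

/-- A quantum convolutional code with stabilizer `A₀ + D Ã₁`. -/
theorem exists_quantumConvolutionalCode (hμ : μ ≤ κ) (hμ0 : 0 < μ)
    {B₀ : Matrix (Fin n) (Fin κ) K} {B₁ : Matrix (Fin n) (Fin μ) K}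
    (hB : IsBlockInverse A₀ A₁ B₀ B₁) (hk : k + 2 * κ = n)
    (hσF : ∀ x : F, σ (algebraMap F K x) = algebraMap F K x) (hσ : ∀ x, σ (σ x) = x)
    (hne : ∃ γ, σ γ ≠ γ)
    (hself : rowModule (unitMemoryMatrix A₀ A₁) ≤
      convDual σ (rowModule (unitMemoryMatrix A₀ A₁))) :
    ∃ Q : QuantumConvolutionalCode F n k, Q.memory = 1 ∧ ∀ s,
      s ∈ Q.stabilizer ↔ pairWord β s ∈ rowModule (unitMemoryMatrix A₀ A₁) := by
  let e : Fin (n - k) ≃ Fin κ × Fin 2 := (finCongr (by omega)).trans finProdFinEquiv.symm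
  have hsymp : ∀ x y, symplecticForm (stabilizerRow β A₀ A₁ x) (stabilizerRow β A₀ A₁ y) = 0 := by
    intro x y
    have hmem : ∀ x, pairWord β (stabilizerRow β A₀ A₁ x) ∈ rowModule (unitMemoryMatrix A₀ A₁) :=
      fun x => (span_stabilizerRow_iff β A₀ A₁ _).1 (Submodule.subset_span ⟨x, rfl⟩)
    exact symplecticForm_eq_zero β hσF hσ hne
      ((mem_convDual_iff σ).1 (hself (hmem x)) _ (hmem y))
  let Q : QuantumConvolutionalCode F n k :=
    { le := by omega
      xPart := fun i => (stabilizerRow β A₀ A₁ (e i)).1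
      zPart := fun i => (stabilizerRow β A₀ A₁ (e i)).2
      symplectic := by
        refine Matrix.ext fun i i' => ?_
        have := hsymp (e i) (e i')
        rw [symplecticForm, Finset.sum_sub_distrib] at this
        exact this
      basic := by
        refine ⟨fun j i => stabilizerInverse β B₀ j (e i), ?_⟩
        refine Matrix.ext fun i i' =>
          Matrix.mul_apply.trans ((Fintype.sum_sum_type _).trans ?_)
        rw [Matrix.one_apply]
        have := stabilizerRow_mul_inverse β hμ hB (e i) (e i')
        simp only [e.apply_eq_iff_eq] at this
        exact this }
  refine ⟨Q, ?_, fun s => ?_⟩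
  · refine le_antisymm (Finset.sup_le fun i _ => Finset.sup_le fun j _ =>
      max_le (natDegree_linear_le _ _) (natDegree_linear_le _ _)) ?_
    -- For memory at least one: a nonzero entry of A₁ times β₀ has a nonzero coordinate in the basis
    -- β, and that coordinate is a coefficient of D.
    obtain ⟨j, hj⟩ : ∃ j, A₁ ⟨0, hμ0⟩ j ≠ 0 := by
      by_contra! h
      have := congrFun (congrFun hB.one_one ⟨0, hμ0⟩) ⟨0, hμ0⟩
      simp [Matrix.mul_apply, h] at this
    set i := Fin.castLE hμ ⟨0, hμ0⟩ with hi
    have hpad : padRows κ A₁ i j ≠ 0 := by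
      rw [hi, padRows_castLE]
      exact hj
    have hne0 : β 0 * padRows κ A₁ i j ≠ 0 := mul_ne_zero (β.ne_zero 0) hpad
    have hsup : max ((stabilizerRow β A₀ A₁ (i, 0)).1 j).natDegree
        ((stabilizerRow β A₀ A₁ (i, 0)).2 j).natDegree ≤ Q.memory := by
      have h1 := Finset.le_sup (f := fun i => Finset.univ.sup fun j =>
        max (Q.xPart i j).natDegree (Q.zPart i j).natDegree) (Finset.mem_univ (e.symm (i, 0)))
      have h2 := Finset.le_sup (f := fun j => max (Q.xPart (e.symm (i, 0)) j).natDegree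
        (Q.zPart (e.symm (i, 0)) j).natDegree) (Finset.mem_univ j)
      have h3 := h2.trans h1
      simp only [Q, e.apply_symm_apply] at h3
      exact h3
    refine le_trans ?_ hsup
    have hc : ∀ a b : F, (C a + X * C b).coeff 1 = b := by
      intro a b
      rw [coeff_add, coeff_C_succ, coeff_X_mul, coeff_C_zero, zero_add]
    by_cases h0 : β.repr (β 0 * padRows κ A₁ i j) 0 = 0
    · have h1 : β.repr (β 0 * padRows κ A₁ i j) 1 ≠ 0 := by
        intro h1
        refine hne0 ?_
        rw [← repr_add_eq β (β 0 * padRows κ A₁ i j), h0, h1]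
        simp
      refine le_max_of_le_right (le_natDegree_of_ne_zero ?_)
      rw [stabilizerRow, hc]
      exact h1
    · refine le_max_of_le_left (le_natDegree_of_ne_zero ?_)
      rw [stabilizerRow, hc]
      exact h0
  · rw [← span_stabilizerRow_iff]
    have : Q.stabilizer = Submodule.span F[X] (Set.range (stabilizerRow β A₀ A₁)) := by
      rw [QuantumConvolutionalCode.stabilizer]
      congr 1
      exact e.surjective.range_comp (stabilizerRow β A₀ A₁)
    rw [this]

end Quantum


/-! ## The quantum convolutional BCH code -/

section Main

theorem mul_lt_of_lt_floor {n q r M : ℕ} (hq : 2 ≤ q)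
    (h : M < ⌊(n : ℚ) * ((q : ℚ) ^ r - 1) / ((q : ℚ) ^ (2 * r) - 1)⌋₊) :
    0 < r ∧ M * (q ^ r + 1) < n := by
  have hr : 0 < r := by
    -- For r = 0 the quotient is 0/0, which evaluates to 0, so nothing lies below its floor.
    rcases Nat.eq_zero_or_pos r with rfl | hr
    · simp at h
    · exact hr
  refine ⟨hr, ?_⟩
  have h1 : (1 : ℚ) < (q : ℚ) ^ r := one_lt_pow₀ (by exact_mod_cast hq) hr.ne'
  have h2 := (Nat.le_floor_iff' (Nat.succ_ne_zero M)).1 (Nat.succ_le_of_lt h)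
  have e : (n : ℚ) * ((q : ℚ) ^ r - 1) / ((q : ℚ) ^ (2 * r) - 1) = n / ((q : ℚ) ^ r + 1) := by
    rw [mul_comm 2 r, pow_mul, div_eq_div_iff (by nlinarith) (by linarith)]
    ring
  rw [e, le_div_iff₀ (by linarith)] at h2
  have h3 : (M + 1) * (q ^ r + 1) ≤ n := by
    rw [Nat.succ_eq_add_one] at h2
    exact_mod_cast h2
  have h4 : (M + 1) * (q ^ r + 1) = M * (q ^ r + 1) + (q ^ r + 1) := by ring
  omega

theorem pow_two_mul_modEq_one {n q r : ℕ} (hr : r = orderOf ((q : ZMod n) ^ 2)) :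
    q ^ (2 * r) ≡ 1 [MOD n] := by
  rw [← ZMod.natCast_eq_natCast_iff]
  push_cast
  rw [pow_mul, hr, pow_orderOf_eq_one]

theorem Icc_filter_union (p : ℕ → Prop) [DecidablePred p] (δ : ℕ) :
    (Finset.Icc 1 δ).filter p ∪ (Finset.Icc (δ + 1) (2 * δ)).filter p =
      (Finset.Icc 1 (2 * δ)).filter p := by
  rw [← Finset.filter_union]
  congr 1
  ext x
  simp only [Finset.mem_union, Finset.mem_Icc]
  omega

theorem Icc_filter_disjoint (p : ℕ → Prop) [DecidablePred p] (δ : ℕ) :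
    Disjoint ((Finset.Icc 1 δ).filter p) ((Finset.Icc (δ + 1) (2 * δ)).filter p) := by
  refine Finset.disjoint_filter_filter (Finset.disjoint_left.2 fun x hx hx' => ?_)
  simp only [Finset.mem_Icc] at hx hx'
  omega

theorem two_mul_div_le (Q δ : ℕ) : 2 * (δ / Q) ≤ 2 * δ / Q := by
  rcases Nat.eq_zero_or_pos Q with rfl | hQ
  · simp
  · rw [Nat.le_div_iff_mul_le hQ, mul_assoc]
    exact Nat.mul_le_mul_left 2 (Nat.div_mul_le_self δ Q)

variable {K E : Type*} [Field K] [Field E] [Algebra K E] {ζ : E} {n : ℕ}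

theorem evalCode_union (X Y : Finset ℕ) :
    evalCode K ζ n (X ∪ Y) = evalCode K ζ n X ⊓ evalCode K ζ n Y := by
  ext c
  simp only [Submodule.mem_inf, mem_evalCode, Finset.mem_union]
  exact ⟨fun h => ⟨fun x hx => h x (Or.inl hx), fun x hx => h x (Or.inr hx)⟩,
    fun h x hx => hx.elim (h.1 x) (h.2 x)⟩

variable [Fintype K]

theorem bchCode_eq_inf (hζ : IsPrimitiveRoot ζ n) (δ : ℕ) :
    bchCode K ζ n (2 * δ + 1) = bchCode K ζ n (δ + 1) ⊓ intervalCode K ζ n (δ + 1) (2 * δ) := by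
  rw [bchCode_eq_evalCode hζ, bchCode_eq_evalCode hζ, intervalCode_eq_evalCode hζ,
    ← evalCode_union, Icc_filter_union]

/-- Both lower bounds for the weight of a nonzero word of the convolutional BCH code. -/
theorem le_weight_of_mem_unitMemoryDual [DecidableEq K] (hζ : IsPrimitiveRoot ζ n)
    (hKn : Nat.Coprime (Nat.card K) n) {δ κ μ : ℕ} (hδ : 1 ≤ δ) (hμ : μ ≤ κ)
    {H₀ : Matrix (Fin κ) (Fin n) K} {H₁ : Matrix (Fin μ) (Fin n) K}
    (h₀ : IsParityCheck H₀ (bchCode K ζ n (δ + 1)))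
    (h₁ : IsParityCheck H₁ (intervalCode K ζ n (δ + 1) (2 * δ))) {w : Fin n → K[X]}
    (hw : w ∈ unitMemoryDual H₀ H₁) (hw0 : w ≠ 0) :
    δ + 1 + distBound (Nat.card K) (δ + 1) (2 * δ) ≤ ∑ j, (w j).support.card ∧
    min (δ + 1 + minDist (intervalCode K ζ n (δ + 1) (2 * δ)))
      (minDist (bchCode K ζ n (2 * δ + 1))) ≤ ∑ j, (w j).support.card := by
  have hK : 2 ≤ Nat.card K := Finite.one_lt_card
  obtain ⟨s, t, hs0, ht0, hs, ht⟩ := exists_first_last hμ hw hw0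
  rw [← h₁.2] at hs
  rw [← h₀.2] at ht
  have hmin : ∀ {C : Submodule K (Fin n → K)} {c : Fin n → K}, c ∈ C → c ≠ 0 →
      minDist C ≤ hammingNorm c := fun hc hc0 => Nat.sInf_le ⟨_, hc, hc0, rfl⟩
  -- If both extreme coefficients are the same one, it lies in the intersection B_{2δ+1}; otherwise
  -- they occupy different frames and their weights add.
  by_cases hst : s = t
  · subst hst
    have hmem : coeffWord w s ∈ bchCode K ζ n (2 * δ + 1) := by
      rw [bchCode_eq_inf hζ]
      exact ⟨ht, hs⟩
    have h1 := hammingNorm_le_sum_card_support w s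
    have h2 := le_hammingNorm_of_mem_bchCode hζ (by omega) hmem hs0
    have h3 := distBound_le hK hδ
    exact ⟨by omega, (min_le_right _ _).trans ((hmin hmem hs0).trans h1)⟩
  · have h1 := hammingNorm_add_le_sum_card_support w hst
    have h2 := le_hammingNorm_of_mem_bchCode hζ (by omega) ht ht0
    have h3 := distBound_le_hammingNorm hζ rfl hKn hK (by omega) (by omega) hs hs0
    have h4 := hmin hs hs0
    exact ⟨by omega, (min_le_left _ _).trans (by omega)⟩

end Main

end QConv

open QConv

theorem mainTheorem4 {F K E : Type*} [Field F] [Fintype F] [Field K] [Fintype K] [DecidableEq K]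
    [Field E] [Algebra F K] [Algebra K E] (q n r δ κ : ℕ)
    (hF : Fintype.card F = q) (hK : Fintype.card K = q ^ 2)
    (hn : Nat.Coprime n q) (ζ : E) (hζ : IsPrimitiveRoot ζ n)
    (hr : r = orderOf ((q : ZMod n) ^ 2))
    (hδ : 2 ≤ 2 * δ)
    (hδ' : 2 * δ < ⌊(n : ℚ) * ((q : ℚ) ^ r - 1) / ((q : ℚ) ^ (2 * r) - 1)⌋₊)
    (hκ : κ = r * ⌈(δ : ℚ) * (1 - 1 / (q : ℚ) ^ 2)⌉₊) :
    ∃ k : ℕ, k + 2 * κ = n ∧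
      ∃ (W : Submodule (Polynomial K) (Fin n → Polynomial K))
        (Q : QConv.QuantumConvolutionalCode F n k),
        QConv.IsConvolutionalBCH ζ δ W ∧
        QConv.IsConvolutionalCodeWithMemory W (n - κ) 1 ∧
        QConv.hermitianDual q W ≤ W ∧
        Q.HasStabilizerCode (QConv.hermitianDual q W) ∧
        Q.memory = 1 ∧
        δ + 1 + QConv.distBound (q ^ 2) (δ + 1) (2 * δ) ≤ Q.freeDistance ∧
        min (δ + 1 + QConv.minDist (QConv.intervalCode K ζ n (δ + 1) (2 * δ)))
          (QConv.minDist (QConv.bchCode K ζ n (2 * δ + 1))) ≤ Q.freeDistance := by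
  classical
  have hq2 : 2 ≤ q := hF ▸ Fintype.one_lt_card
  have hKc : Nat.card K = q ^ 2 := by rw [Nat.card_eq_fintype_card, hK]
  obtain ⟨hr0, hM⟩ := mul_lt_of_lt_floor hq2 hδ'
  have hrmod := pow_two_mul_modEq_one hr
  have hn0 : 0 < n := by omega
  have hδ1 : 1 ≤ δ := by omega
  have hrmod' : Fintype.card K ^ r ≡ 1 [MOD n] := by rwa [hK, ← pow_mul]
  have hceil : κ = r * (δ - δ / q ^ 2) := by
    have := ceil_mul_one_sub_inv (Q := q ^ 2) (by positivity) δ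
    push_cast at this
    rw [hκ, this]
  -- the representatives of the cosets
  set X₀ := (Finset.Icc 1 δ).filter fun x => ¬ Nat.card K ∣ x with hX₀
  set X₁ := (Finset.Icc (δ + 1) (2 * δ)).filter fun x => ¬ Nat.card K ∣ x with hX₁
  set X := (Finset.Icc 1 (2 * δ)).filter fun x => ¬ Nat.card K ∣ x with hX
  have hcard₀ : X₀.card = δ - δ / q ^ 2 := by rw [hX₀, card_filter_not_dvd, hKc]
  have hcard : X.card = 2 * δ - 2 * δ / q ^ 2 := by rw [hX, card_filter_not_dvd, hKc]
  have hunion : X₀ ∪ X₁ = X := Icc_filter_union _ δ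
  have hcardadd : X₀.card + X₁.card = X.card := by
    rw [← hunion, Finset.card_union_of_disjoint (Icc_filter_disjoint _ δ)]
  have hXprop : ∀ x ∈ X, 1 ≤ x ∧ x ≤ 2 * δ ∧ ¬ q ^ 2 ∣ x := by
    intro x hx
    rw [hX, Finset.mem_filter, Finset.mem_Icc, hKc] at hx
    exact ⟨hx.1.1, hx.1.2, hx.2⟩
  have hinj : ∀ Y ⊆ X, Set.InjOn (fun p : ℕ × ℕ => p.1 * Fintype.card K ^ p.2 % n)
      (Y ×ˢ Finset.range r : Finset (ℕ × ℕ)) := by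
    intro Y hY
    rw [hK]
    exact injOn_mul_pow_mod hn hrmod hM (by omega) fun x hx => hXprop x (hY hx)
  have hX₀X : X₀ ⊆ X := hunion ▸ Finset.subset_union_left
  have hX₁X : X₁ ⊆ X := hunion ▸ Finset.subset_union_right
  -- the parity check matrices
  have hd₀ := finrank_evalCode hζ hn0 hr0.ne' hrmod' (hinj X₀ hX₀X)
  have hd₁ := finrank_evalCode hζ hn0 hr0.ne' hrmod' (hinj X₁ hX₁X)
  have hd := finrank_evalCode hζ hn0 hr0.ne' hrmod' (hinj X subset_rfl)
  have hbch₀ : bchCode K ζ n (δ + 1) = evalCode K ζ n X₀ := bchCode_eq_evalCode hζ δ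
  have hint : intervalCode K ζ n (δ + 1) (2 * δ) = evalCode K ζ n X₁ :=
    intervalCode_eq_evalCode hζ _ _
  have hbch : bchCode K ζ n (2 * δ + 1) = evalCode K ζ n X := bchCode_eq_evalCode hζ _
  set μ := r * X₁.card with hμdef
  have hκX : r * X₀.card = κ := by rw [hceil, hcard₀]
  rw [hκX] at hd₀
  have hκμ : r * X.card = κ + μ := by rw [← hcardadd, mul_add, hκX]
  rw [hκμ] at hd
  -- The upper half of [1, 2δ] contains at least as many multiples of q² as the lower half, so it
  -- has no more representatives.
  have hμ : μ ≤ κ := by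
    rw [← hκX, hμdef]
    refine Nat.mul_le_mul_left r ?_
    have := two_mul_div_le (q ^ 2) δ
    have := Nat.div_le_self δ (q ^ 2)
    omega
  have hμ0 : 0 < μ := by
    refine Nat.mul_pos hr0 ?_
    -- With q² ≥ 4 fewer than δ multiples of q² lie in [1, 2δ], so the upper half contributes at
    -- least one representative.
    have h1 : 2 * δ / q ^ 2 ≤ δ / 2 := by
      have h4 : 4 ≤ q ^ 2 := by nlinarith
      refine (Nat.div_le_div_left h4 (by norm_num)).trans ?_
      omega
    generalize δ / q ^ 2 = a at hcard₀
    generalize 2 * δ / q ^ 2 = b at hcard h1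
    omega
  obtain ⟨H₀, hH₀⟩ := exists_isParityCheck _ hd₀
  obtain ⟨H₁, hH₁⟩ := exists_isParityCheck _ hd₁
  have hH : IsParityCheck (Matrix.fromRows H₀ H₁) (evalCode K ζ n X) :=
    hH₀.fromRows hH₁ (by rw [← hunion, evalCode_union]) hd
  obtain ⟨B₀, B₁, hB⟩ := exists_isBlockInverse hH.1
  -- the Frobenius involution
  obtain ⟨σ, hσq⟩ : ∃ σ : K →+* K, ∀ x, σ x = x ^ q :=
    ⟨(FiniteField.frobeniusAlgHom F K : K →+* K), fun x => by simp [hF]⟩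
  have hσ : ∀ x, σ (σ x) = x := by
    intro x
    rw [hσq, hσq, ← pow_mul, ← sq, ← hK, FiniteField.pow_card]
  have hσF : ∀ x : F, σ (algebraMap F K x) = algebraMap F K x := by
    intro x
    rw [hσq, ← map_pow, ← hF, FiniteField.pow_card]
  have hne : ∃ γ, σ γ ≠ γ := by
    obtain ⟨γ, hγ⟩ := exists_ne_of_pow (K := K) hF hK
    exact ⟨γ, by rwa [hσq]⟩
  obtain ⟨φ, hφ⟩ : ∃ φ : E →+* E, ∀ y, φ y = y ^ q := by
    -- Viewing E over F makes y ↦ y^q a ring homomorphism of E.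
    let := ((algebraMap K E).comp (algebraMap F K)).toAlgebra
    exact ⟨(FiniteField.frobeniusAlgHom F E : E →+* E), fun x => by simp [hF]⟩
  have hdvd : ∀ z ∈ cosetUnion (Fintype.card K) n r X,
      ∀ w ∈ cosetUnion (Fintype.card K) n r X, ¬ n ∣ z + q * w := by
    intro z hz w hw hd
    simp only [cosetUnion, Finset.mem_image, Finset.mem_product, Prod.exists] at hz hw
    obtain ⟨x, i, ⟨hx, -⟩, rfl⟩ := hz
    obtain ⟨y, j, ⟨hy, -⟩, rfl⟩ := hw
    obtain ⟨hx1, hx2, -⟩ := hXprop x hx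
    obtain ⟨hy1, hy2, -⟩ := hXprop y hy
    -- The factor q turns the even exponent 2j of the second coset into an odd one.
    refine not_dvd_mul_pow_add_mul_pow hn hrmod hr0 hM (by omega) hx1 hx2 hy1 hy2 (2 * i)
      (2 * j + 1) ?_
    have h1 : x * q ^ (2 * i) + y * q ^ (2 * j + 1) ≡
        x * Fintype.card K ^ i % n + q * (y * Fintype.card K ^ j % n) [MOD n] := by
      rw [hK, ← pow_mul, ← pow_mul, show y * q ^ (2 * j + 1) = q * (y * q ^ (2 * j)) by ring]
      exact ((Nat.mod_modEq _ n).add ((Nat.mod_modEq _ n).mul_left q)).symm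
    rwa [h1.dvd_iff dvd_rfl]
  have horth : ∀ x y, ∑ j, Matrix.fromRows H₀ H₁ x j * σ (Matrix.fromRows H₀ H₁ y j) = 0 := by
    intro x y
    simp only [hσq]
    exact hermitian_orthogonal hζ hn0 hr0.ne' hrmod' (hinj X subset_rfl) φ hφ hdvd
      (hH.row_orthogonal x) (hH.row_orthogonal y)
  -- the convolutional code and its Hermitian dual
  have hherm : hermitianDual q (unitMemoryDual H₀ H₁) =
      rowModule (unitMemoryMatrix (H₀.map σ) (H₁.map σ)) := by
    rw [← convDual_unitMemoryDual hμ hB hσ, hermitianDual]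
    congr 1
    exact funext fun x => (hσq x).symm
  have hle : rowModule (unitMemoryMatrix (H₀.map σ) (H₁.map σ)) ≤ unitMemoryDual H₀ H₁ :=
    rowModule_conj_le hμ horth
  -- From κ ≤ rδ and r < q^r one gets 2κ ≤ 2δ q^r, which is below n by `hM`.
  have h2κ : 2 * κ < n := by
    have h1 : κ ≤ r * δ := by
      rw [hceil]
      exact Nat.mul_le_mul_left r (Nat.sub_le _ _)
    have h2 : r < q ^ r := Nat.lt_pow_self hq2
    nlinarith
  obtain ⟨k, hk⟩ : ∃ k, k + 2 * κ = n := ⟨n - 2 * κ, by omega⟩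
  have hfin : Module.finrank F K = 2 := by
    have := Module.card_eq_pow_finrank (K := F) (V := K)
    rw [hF, hK] at this
    exact (Nat.pow_right_injective hq2 this).symm
  let β : Module.Basis (Fin 2) F K := Module.finBasisOfFinrankEq F K hfin
  have hconj := convDual_conj (H₀ := H₀) (H₁ := H₁) hσ
  obtain ⟨Q, hQm, hQs⟩ := exists_quantumConvolutionalCode β hμ hμ0 (hB.map σ) hk hσF hσ hne
    (hle.trans hconj.ge)
  have hword : ∀ s, (∀ t ∈ Q.stabilizer, symplecticForm s t = 0) →
      pairWord β s ∈ unitMemoryDual H₀ H₁ := by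
    intro s hs
    rw [← hconj]
    exact pairWord_mem_convDual β hσF hσ hne fun t ht => hs t ((hQs t).2 ht)
  -- An infimum over the empty set would be 0 and ruin the lower bounds. A witness exists because W
  -- has rank n - κ > κ, exceeding that of its Hermitian dual.
  have hnonempty : ∃ s, (∀ t ∈ Q.stabilizer, symplecticForm s t = 0) ∧ s ∉ Q.stabilizer := by
    obtain ⟨u, huW, huV⟩ : ∃ u ∈ unitMemoryDual H₀ H₁,
        u ∉ rowModule (unitMemoryMatrix (H₀.map σ) (H₁.map σ)) := by
      by_contra! h
      have h1 := Submodule.finrank_mono (R := K[X]) (show unitMemoryDual H₀ H₁ ≤ _ from h)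
      have h2 := finrank_unitMemoryDual hμ hB
      have h3 : Module.finrank K[X] (rowModule (unitMemoryMatrix (H₀.map σ) (H₁.map σ))) ≤ κ :=
        (finrank_range_le_card _).trans (by simp)
      omega
    obtain ⟨s, rfl⟩ := pairWord_surjective β u
    refine ⟨s, fun t ht => ?_, fun hs => huV ((hQs s).1 hs)⟩
    rw [← hconj, mem_convDual_iff] at huW
    exact symplecticForm_eq_zero β hσF hσ hne (huW _ ((hQs t).1 ht))
  have hKn : Nat.Coprime (Nat.card K) n := by
    rw [hKc]
    exact (hn.pow_right 2).symm
  have hdist : δ + 1 + distBound (Nat.card K) (δ + 1) (2 * δ) ≤ Q.freeDistance ∧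
      min (δ + 1 + minDist (intervalCode K ζ n (δ + 1) (2 * δ)))
        (minDist (bchCode K ζ n (2 * δ + 1))) ≤ Q.freeDistance := by
    obtain ⟨s₀, h1, h2⟩ := hnonempty
    obtain ⟨s, hs, hs', hw⟩ := Nat.sInf_mem (s := {w | ∃ s, (∀ t ∈ Q.stabilizer,
      symplecticForm s t = 0) ∧ s ∉ Q.stabilizer ∧ symplecticWeight s = w}) ⟨_, s₀, h1, h2, rfl⟩
    rw [QuantumConvolutionalCode.freeDistance, ← hw, symplecticWeight_eq β]
    refine le_weight_of_mem_unitMemoryDual hζ hKn hδ1 hμ (hbch₀ ▸ hH₀) (hint ▸ hH₁) (hword s hs) ?_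
    intro h0
    refine hs' ((hQs s).2 ?_)
    rw [h0]
    exact zero_mem _
  rw [hKc] at hdist
  refine ⟨k, hk, unitMemoryDual H₀ H₁, Q, ⟨κ, μ, H₀, H₁, hμ, hbch₀ ▸ hH₀, hint ▸ hH₁, hbch ▸ hH,
    rfl⟩, isConvolutionalCodeWithMemory_unitMemoryDual hμ hμ0 hB, hherm ▸ hle, ?_, hQm, hdist⟩
  rw [hherm]
  exact ⟨β, fun x z => hQs (x, z)⟩
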